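/- Let $\mathfrak g\neq 0$ be a semisimple Lie algebra over an algebraically closed field $F$ of characteristic $0$, and let $G$ be a connected semisimple algebraic group with Lie algebra $\mathfrak g$. Let $\mathfrak s^{\mathrm{pr}}\subset\mathfrak g$ be a principal $\mathfrak{sl}_2$-subalgebra, i.e. one spanned by an $\mathfrak{sl}_2$-triple $(h,e,f)$ whose nilpotent element $e$ has a centralizer in $\mathfrak g$ of dimension $\operatorname{rk}\mathfrak g$, and let $S^{\mathrm{pr}}\subset G$ be the corresponding connected subgroup, the image of a homomorphism $SL_2\to G$. For a positive integer $m$ let $s_m\in S^{\mathrm{pr}}$ be the image of $\operatorname{diag}(\varepsilon_{2m},\varepsilon_{2m}^{-1})$, where $\varepsilon_{2m}\in F$ is a primitive $2m$-th root of unity, let $\sigma_m=\mathrm{Ad}(s_m)$, and set $d(m)=\dim\mathfrak g^{\sigma_m}$, the dimension of the fixed-point subalgebra of $\sigma_m$ (it does not depend on the choice of $\varepsilon_{2m}$). The Coxeter number of a simple Lie algebra is the order of a Coxeter element of its Weyl group, and $h(\mathfrak g)$ denotes the maximum of the Coxeter numbers of the simple ideals of $\mathfrak g$. **Proposition 2.2.**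 Let $m$ and $m'$ be positive integers. If $m'<m$, then $d(m')\ge d(m)$. Moreover, if $m'$ divides $m$, $m'\ne m$ and $m<h(\mathfrak g)$, then $d(m')>d(m)$. -/

import Mathlib

namespace PrincipalAutomorphism

section Principal

variable (F : Type*) [Field F] {L : Type*} [LieRing L] [LieAlgebra F L]

/-- `(h, e, f)` is the standard basis of a principal `sl₂`-subalgebra: it is an `sl₂`-triple and the
nilpotent element `e` is principal (regular), i.e. the dimension of its centralizer
`{x | ⁅e, x⁆ = 0}` equals the rank of the Lie algebra. -/
structure IsPrincipalSl2Triple [FiniteDimensional F L] (h e f : L) : Prop where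
  isSl2Triple : IsSl2Triple h e f
  finrank_centralizer :
    Module.finrank F (LinearMap.ker (LieAlgebra.ad F L e : Module.End F L)) = LieAlgebra.rank F L

/-- `exp (ad x)` for an ad-nilpotent element `x` of a finite-dimensional Lie algebra `L` over a field
of characteristic zero: the powers of a nilpotent endomorphism vanish from the exponent `dim L` on,
so this is the whole exponential series. -/
noncomputable def expAd (x : L) : Module.End F L :=
  ∑ k ∈ Finset.range (Module.finrank F L),
    (k.factorial : F)⁻¹ • (LieAlgebra.ad F L x : Module.End F L) ^ k

variable {F}

/-- The action on `L` of the matrix `!![0, t; -t⁻¹, 0]` of `SL₂(F)` through the adjoint action of the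
connected subgroup with Lie algebra spanned by the `sl₂`-triple `(h, e, f)`. In `SL₂(F)` one has
`!![0, t; -t⁻¹, 0] = !![1, t; 0, 1] * !![1, 0; -t⁻¹, 1] * !![1, t; 0, 1]`, where `!![1, t; 0, 1]`
acts as `exp (ad (t e))` and `!![1, 0; u, 1]` acts as `exp (ad (u f))`. -/
noncomputable def weylAd (e f : L) (t : F) : Module.End F L :=
  expAd F (t • e) * expAd F (-t⁻¹ • f) * expAd F (t • e)

/-- The action on `L` of the matrix `diag(t, t⁻¹)` of `SL₂(F)` through the adjoint action of the
connected subgroup with Lie algebra spanned by the `sl₂`-triple `(h, e, f)`. In `SL₂(F)` one has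
`diag(t, t⁻¹) = !![0, t; -t⁻¹, 0] * !![0, -1; 1, 0]`. For a principal triple and a primitive `2m`-th
root of unity `t` this is the principal automorphism of order `m`. -/
noncomputable def torusAd (e f : L) (t : F) : Module.End F L :=
  weylAd e f t * weylAd e f (-1)

/-- The dimension of the space of fixed points of the action of `diag(t, t⁻¹)` on `L`. For a
principal triple and a primitive `2m`-th root of unity `t` this is the number `d(m)`. -/
noncomputable def fixedDim (e f : L) (t : F) : ℕ :=
  Module.finrank F (LinearMap.eqLocus (torusAd e f t) (1 : Module.End F L))

end Principal

section Coxeter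

/-- `w` is a Coxeter element of the Weyl group of the root pairing `P` (acting on the space spanned by
the roots): the product, in some order, of the reflections in the simple roots of some base. -/
def IsCoxeterElement {ι R M N : Type*} [CommRing R] [AddCommGroup M] [Module R M]
    [AddCommGroup N] [Module R N] (P : RootPairing ι R M N) (w : M ≃ₗ[R] M) : Prop :=
  ∃ (b : P.Base) (l : List ι), l.Nodup ∧ (∀ i, i ∈ l ↔ i ∈ b.support) ∧
    w = (l.map P.reflection).prod

variable (F : Type*) [Field F] [IsAlgClosed F] [CharZero F]
  (L : Type*) [LieRing L] [LieAlgebra F L] [FiniteDimensional F L]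

/-- The Coxeter number of a simple Lie algebra: the order of a Coxeter element of its Weyl group.
All Cartan subalgebras are conjugate and so are all Coxeter elements, hence the set of orders has
exactly one element, which `sInf` selects. -/
noncomputable def simpleCoxeterNumber [LieAlgebra.IsSimple F L] : ℕ :=
  sInf {n | ∃ (H : LieSubalgebra F L) (_ : H.IsCartanSubalgebra)
    (w : Module.Dual F H ≃ₗ[F] Module.Dual F H),
    IsCoxeterElement (LieAlgebra.IsKilling.rootSystem H) w ∧ n = orderOf w}

/-- The Coxeter number of a semisimple Lie algebra: the maximum of the Coxeter numbers of its
(finitely many) simple ideals, and `1` for the zero Lie algebra. -/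
noncomputable def coxeterNumber : ℕ :=
  sSup ({1} ∪ {n | ∃ (I : LieIdeal F L) (_ : LieAlgebra.IsSimple F I),
    n = simpleCoxeterNumber F I})

end Coxeter

end PrincipalAutomorphism

/-!
Let `e` be principal. By `sl₂`-theory the generalized weights `0` and `1` of `h` together have
multiplicity at most `dim ker (ad e)`, which is the rank; hence the Engel subalgebra of `h` is a
Cartan subalgebra, the weight `1` does not occur, and `L` is the direct sum of the eigenspaces `V j`
of `ad h` for the even eigenvalues `2 * j`. The dimension of `V j` does not increase with `|j|`.
Since `diag(t, t⁻¹)` acts on `V j` as `t ^ (2 * j)`, the fixed point dimension for a primitive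
`2m`-th root of unity is `d m = ∑ i, dim V (m * i)`, which does not increase with `m`.

If `m'` is a proper divisor of `m`, then `d m' > d m` unless `V m' = 0`. In that case put
`m' = n + 1`: each simple ideal `I` has dimension at most `(2 * n + 1) * r`, where `r` is its rank.
On the other hand, projecting the roots of `I` to the Coxeter plane shows that they number at least
`r` times the Coxeter number of `I`, so `dim I` is at least `r * (1 + h I)`. Thus
`h I ≤ 2 * n < 2 * m' ≤ m`.
-/

namespace PrincipalAutomorphism

section SupportGraph

open Matrix

/-- The graph on the indices of a square matrix in which distinct `i` and `j` are adjacent when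
`A i j` or `A j i` is nonzero. For a Cartan matrix this is the Dynkin diagram without multiplicities
and arrows. -/
def supportGraph {I R : Type*} [Zero R] (A : Matrix I I R) : SimpleGraph I :=
  SimpleGraph.fromRel fun i j ↦ A i j ≠ 0

theorem supportGraph_adj_iff {I R : Type*} [Zero R] {A : Matrix I I R}
    (hA : ∀ i j, A i j = 0 → A j i = 0) {i j : I} :
    (supportGraph A).Adj i j ↔ i ≠ j ∧ A i j ≠ 0 := by
  have : A i j = 0 ↔ A j i = 0 := ⟨hA i j, hA j i⟩
  simp [supportGraph, this]

open scoped RealInnerProductSpace in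
theorem exists_nonneg_mulVec_eq_smul_of_isSymm {I : Type*} [Fintype I] [Nonempty I]
    {S : Matrix I I ℝ} (hS : S.IsSymm) (hnonneg : ∀ i j, 0 ≤ S i j) :
    ∃ (c : ℝ) (y : I → ℝ), y ≠ 0 ∧ (∀ i, 0 ≤ y i) ∧ S *ᵥ y = c • y := by
  classical
  let T : EuclideanSpace ℝ I →L[ℝ] EuclideanSpace ℝ I := Matrix.toEuclideanCLM (𝕜 := ℝ) S
  have hT : IsSelfAdjoint T :=
    IsSelfAdjoint.map (show IsSelfAdjoint S from S.conjTranspose_eq_transpose_of_trivial.trans hS)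
      (Matrix.toEuclideanCLM (𝕜 := ℝ))
  have form_apply (x : EuclideanSpace ℝ I) :
      T.reApplyInnerSelf x = ∑ i, ∑ j, S i j * (x i * x j) := by
    simp only [T, ContinuousLinearMap.reApplyInnerSelf_apply, PiLp.inner_apply,
      Matrix.ofLp_toEuclideanCLM, mulVec, dotProduct, RCLike.inner_apply, conj_trivial,
      Finset.mul_sum, RCLike.re_to_real]
    exact Finset.sum_congr rfl fun i _ ↦ Finset.sum_congr rfl fun j _ ↦ by ring
  obtain ⟨x₀, hx₀, hmax⟩ := (isCompact_sphere (0 : EuclideanSpace ℝ I) 1).exists_isMaxOn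
    (NormedSpace.sphere_nonempty.mpr zero_le_one) T.reApplyInnerSelf_continuous.continuousOn
  -- Taking absolute values of the coordinates does not decrease the quadratic form.
  let x : EuclideanSpace ℝ I := WithLp.toLp 2 fun i ↦ |x₀ i|
  have form_le : T.reApplyInnerSelf x₀ ≤ T.reApplyInnerSelf x := by
    rw [form_apply, form_apply]
    refine Finset.sum_le_sum fun i _ ↦ Finset.sum_le_sum fun j _ ↦
      mul_le_mul_of_nonneg_left ?_ (hnonneg i j)
    simp only [x, ← abs_mul]
    exact le_abs_self _
  have hx_norm : ‖x‖ = 1 := by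
    rw [mem_sphere_zero_iff_norm, EuclideanSpace.norm_eq] at hx₀
    simpa [EuclideanSpace.norm_eq, x] using hx₀
  have hx_ne : x ≠ 0 := norm_ne_zero_iff.mp (by simp [hx_norm])
  have hmax' : IsMaxOn T.reApplyInnerSelf (Metric.sphere 0 ‖x‖) x := by
    rw [hx_norm]
    exact fun z hz ↦ (hmax hz).trans form_le
  have heig := (hT.hasEigenvector_of_isMaxOn hx_ne hmax').apply_eq_smul
  exact ⟨_, x, fun h ↦ hx_ne (WithLp.ofLp_injective 2 h), fun i ↦ abs_nonneg _,
    congrArg WithLp.ofLp heig⟩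

theorem exists_nonneg_mulVec_eq_smul {I : Type*} [Fintype I] [Nonempty I]
    {N : Matrix I I ℝ} {d : I → ℝ} (hd : ∀ i, 0 < d i) (hN : ∀ i j, N i j * d j = N j i * d i)
    (hnonneg : ∀ i j, 0 ≤ N i j) :
    ∃ (c : ℝ) (y : I → ℝ), y ≠ 0 ∧ (∀ i, 0 ≤ y i) ∧ N *ᵥ y = c • y := by
  have hs (i : I) : 0 < √(d i) := Real.sqrt_pos.mpr (hd i)
  have hss (i : I) : √(d i) * √(d i) = d i := Real.mul_self_sqrt (hd i).le
  let S : Matrix I I ℝ := Matrix.of fun i j ↦ N i j * √(d j) / √(d i)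
  have hS_apply (i j : I) : S i j = N i j * √(d j) / √(d i) := rfl
  have hS : S.IsSymm := by
    ext i j
    rw [transpose_apply, hS_apply, hS_apply, div_eq_div_iff (hs j).ne' (hs i).ne', mul_assoc,
      mul_assoc, hss, hss, hN]
  obtain ⟨c, z, hz_ne, hz, hSz⟩ := exists_nonneg_mulVec_eq_smul_of_isSymm hS
    fun i j ↦ div_nonneg (mul_nonneg (hnonneg i j) (hs j).le) (hs i).le
  refine ⟨c, fun j ↦ √(d j) * z j, fun h ↦ hz_ne <| funext fun i ↦
    (mul_eq_zero.mp (congrFun h i)).resolve_left (hs i).ne',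
    fun j ↦ mul_nonneg (hs j).le (hz j), funext fun i ↦ ?_⟩
  have hi := congrFun hSz i
  simp only [mulVec, dotProduct, Pi.smul_apply, smul_eq_mul, hS_apply] at hi ⊢
  rw [mul_left_comm, ← hi, Finset.mul_sum]
  refine Finset.sum_congr rfl fun j _ ↦ ?_
  have := (hs i).ne'
  field_simp

theorem pos_of_mulVec_eq_smul {I : Type*} [Fintype I] {N : Matrix I I ℝ}
    (hnonneg : ∀ i j, 0 ≤ N i j) (hN : ∀ i j, N i j = 0 → N j i = 0)
    (hconn : (supportGraph N).Preconnected) {c : ℝ} {y : I → ℝ} (hy_ne : y ≠ 0)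
    (hy : ∀ i, 0 ≤ y i) (heig : N *ᵥ y = c • y) (i : I) : 0 < y i := by
  refine (hy i).lt_of_ne' fun hi ↦ hy_ne <| funext fun j ↦ ?_
  have zero_of_adj {k l : I} (hkl : (supportGraph N).Adj k l) (hk : y k = 0) : y l = 0 := by
    have hsum : ∑ j, N k j * y j = 0 := by
      simpa [mulVec, dotProduct, hk] using congrFun heig k
    rw [Finset.sum_eq_zero_iff_of_nonneg fun j _ ↦ mul_nonneg (hnonneg k j) (hy j)] at hsum
    exact (mul_eq_zero.mp (hsum l (Finset.mem_univ l))).resolve_left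
      ((supportGraph_adj_iff hN).mp hkl).2
  obtain ⟨p⟩ := hconn i j
  induction p with
  | nil => exact hi
  | cons hadj _ ih => exact ih (zero_of_adj hadj hi)

theorem exists_pos_mulVec_eq_smul {I : Type*} [Fintype I] [Nonempty I] {N : Matrix I I ℝ}
    {d : I → ℝ} (hd : ∀ i, 0 < d i) (hN : ∀ i j, N i j * d j = N j i * d i)
    (hnonneg : ∀ i j, 0 ≤ N i j) (hconn : (supportGraph N).Preconnected) :
    ∃ (c : ℝ) (y : I → ℝ), 0 ≤ c ∧ (∀ i, 0 < y i) ∧ N *ᵥ y = c • y := by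
  obtain ⟨c, y, hy_ne, hy, heig⟩ := exists_nonneg_mulVec_eq_smul hd hN hnonneg
  have eq_zero_symm (i j : I) (h : N i j = 0) : N j i = 0 :=
    (mul_eq_zero.mp ((hN i j).symm.trans (by rw [h, zero_mul]))).resolve_right (hd i).ne'
  have hpos := pos_of_mulVec_eq_smul hnonneg eq_zero_symm hconn hy_ne hy heig
  obtain ⟨i⟩ := ‹Nonempty I›
  have hi : ∑ j, N i j * y j = c * y i := congrFun heig i
  exact ⟨c, y, nonneg_of_mul_nonneg_left
    (hi ▸ Finset.sum_nonneg fun j _ ↦ mul_nonneg (hnonneg i j) (hy j)) (hpos i), hpos, heig⟩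

theorem not_posDef_mul_diagonal_of_isCycle {I : Type*} [Fintype I] [DecidableEq I]
    {A : Matrix I I ℤ} {d : I → ℤ} (hd : ∀ i, 0 < d i) (hdiag : ∀ i, A i i = 2)
    (hle : ∀ i j, i ≠ j → A i j ≤ 0) (hsymm : ∀ i j, A i j = 0 → A j i = 0)
    {u : I} {p : (supportGraph A).Walk u u} (hp : p.IsCycle) :
    ¬ (A * diagonal d).PosDef := by
  intro hA
  -- The quadratic form is evaluated at the indicator vector of the vertices of the cycle.
  let s : Finset I := p.support.toFinset
  let x : I → ℤ := fun i ↦ if i ∈ s then 1 else 0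
  have column_nonpos (j : I) (hj : j ∈ s) : ∑ i ∈ s, A i j ≤ 0 := by
    have two_le : 2 ≤ ((s.erase j).filter (A · j ≠ 0)).card := by
      rw [← hp.ncard_neighborSet_toSubgraph_eq_two (List.mem_toFinset.mp hj),
        ← Set.ncard_coe_finset]
      refine Set.ncard_le_ncard (fun i hi ↦ ?_) (Finset.finite_toSet _)
      have hij := (supportGraph_adj_iff hsymm).mp (p.toSubgraph.adj_sub hi).symm
      simpa [s, hij] using p.toSubgraph.edge_vert (SimpleGraph.Subgraph.Adj.symm hi)
    calc ∑ i ∈ s, A i j = 2 + ∑ i ∈ s.erase j, A i j := by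
          rw [← Finset.add_sum_erase s _ hj, hdiag]
      _ ≤ 2 + ∑ i ∈ s.erase j, if A i j ≠ 0 then (-1 : ℤ) else 0 := by
          gcongr with i hi
          have := hle i j (Finset.ne_of_mem_erase hi)
          split_ifs <;> omega
      _ ≤ 0 := by
          rw [Finset.sum_ite, Finset.sum_const, Finset.sum_const_zero]
          simp only [nsmul_eq_mul, mul_neg, mul_one, add_zero]
          omega
  have hx : x ≠ 0 := fun h ↦ by simpa [x, s] using congrFun h u
  refine (hA.dotProduct_mulVec_pos hx).not_ge ?_
  have form_eq : star x ⬝ᵥ ((A * diagonal d) *ᵥ x) = ∑ j ∈ s, (∑ i ∈ s, A i j) * d j := by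
    simp only [dotProduct, mulVec, mul_diagonal, x, Pi.star_apply, star_trivial, ite_mul,
      one_mul, zero_mul, mul_ite, mul_one, mul_zero, Finset.sum_ite_mem, Finset.univ_inter,
      Finset.sum_mul]
    exact Finset.sum_comm
  rw [form_eq]
  exact Finset.sum_nonpos fun j hj ↦
    mul_nonpos_of_nonpos_of_nonneg (column_nonpos j hj) (hd j).le

end SupportGraph

section CoxeterPlane

/-- The linear part `z ↦ -p² z̄` of the reflection of the complex plane that maps the unit vector
`p` to `-p`. -/
noncomputable def planeReflection (p : ℂ) : ℂ →+ ℂ :=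
  -(AddMonoidHom.mulLeft (p ^ 2)).comp (starRingEnd ℂ : ℂ →+ ℂ)

theorem planeReflection_apply (p z : ℂ) : planeReflection p z = -(p ^ 2 * starRingEnd ℂ z) := rfl

theorem sub_planeReflection_apply {p : ℂ} (hp : ‖p‖ = 1) (q : ℂ) :
    q - planeReflection p q = (2 * (starRingEnd ℂ p * q).re : ℝ) * p := by
  have h : starRingEnd ℂ p * p = 1 := by
    rw [mul_comm, Complex.mul_conj', hp]; simp
  have hre : ((2 * (starRingEnd ℂ p * q).re : ℝ) : ℂ) =
      starRingEnd ℂ p * q + p * starRingEnd ℂ q := by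
    rw [← Complex.add_conj, map_mul, Complex.conj_conj]
  rw [hre, planeReflection_apply]
  linear_combination -q * h

theorem planeReflection_planeReflection_one (ω z : ℂ) :
    planeReflection (-ω) (planeReflection 1 z) = ω ^ 2 * z := by
  simp [planeReflection_apply]

theorem exists_sign_forall_zpow_ne {K : Type*} [Field K] [NeZero (2 : K)] {ω : K} (hω : ω ≠ 0) :
    ∃ ε : ℤˣ, ∀ k : ℤ, ω ^ (2 * k) ≠ ε • ω := by
  by_contra! h
  obtain ⟨k, hk⟩ := h 1
  obtain ⟨l, hl⟩ := h (-1)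
  have hk' : ω ^ (2 * k - 1) = 1 := by
    rw [zpow_sub_one₀ hω, hk, one_smul, mul_inv_cancel₀ hω]
  have hl' : ω ^ (2 * l - 1) = -1 := by
    rw [zpow_sub_one₀ hω, hl, Units.neg_smul, one_smul, neg_mul, mul_inv_cancel₀ hω]
  have : (1 : K) = -1 :=
    calc (1 : K) = (ω ^ (2 * k - 1)) ^ (2 * l - 1) := by rw [hk', one_zpow]
      _ = (ω ^ (2 * l - 1)) ^ (2 * k - 1) := zpow_comm ..
      _ = -1 := by rw [hl', Odd.neg_one_zpow ⟨k - 1, by ring⟩]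
  exact two_ne_zero (show (2 : K) = 0 by linear_combination this)

end CoxeterPlane

section WeylGroup

variable {ι R M N : Type*} [CommRing R] [AddCommGroup M] [Module R M] [AddCommGroup N] [Module R N]
  {P : RootPairing ι R M N}

theorem root_prod_reflectionPerm (l : List ι) (i : ι) :
    P.root ((l.map P.reflectionPerm).prod i) = (l.map P.reflection).prod (P.root i) := by
  induction l with
  | nil => simp
  | cons j l ih => simp [Equiv.Perm.mul_apply, LinearEquiv.mul_apply, P.root_reflectionPerm, ih]

theorem reflectionPerm_prod_reflectionPerm (l : List ι) (i : ι) :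
    P.reflectionPerm ((l.map P.reflectionPerm).prod i) =
      (l.map P.reflectionPerm).prod * P.reflectionPerm i * (l.map P.reflectionPerm).prod⁻¹ := by
  induction l with
  | nil => simp
  | cons j l ih =>
    have conj (k : ι) : P.reflectionPerm (P.reflectionPerm j k) =
        P.reflectionPerm j * P.reflectionPerm k * P.reflectionPerm j := by
      ext m
      apply P.root.injective
      simp [Equiv.Perm.mul_apply, P.root_reflectionPerm, P.reflection_reflectionPerm]
    rw [List.map_cons, List.prod_cons, Equiv.Perm.mul_apply, conj, ih, mul_inv_rev,
      P.reflectionPerm_inv]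
    group

theorem orderOf_prod_reflection_dvd [P.IsRootSystem] (l : List ι) :
    orderOf (l.map P.reflection).prod ∣ orderOf (l.map P.reflectionPerm).prod := by
  have root_pow (n : ℕ) (i : ι) : P.root (((l.map P.reflectionPerm).prod ^ n) i) =
      ((l.map P.reflection).prod ^ n) (P.root i) := by
    induction n generalizing i with
    | zero => simp
    | succ n ih =>
      rw [pow_succ, pow_succ, Equiv.Perm.mul_apply, ih, root_prod_reflectionPerm,
        LinearEquiv.mul_apply]
  refine orderOf_dvd_of_pow_eq_one <| LinearEquiv.toLinearMap_injective <|
    LinearMap.ext_on_range (RootPairing.IsRootSystem.span_root_eq_top (P := P)) fun i ↦ ?_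
  have := root_pow (orderOf (l.map P.reflectionPerm).prod) i
  rw [pow_orderOf_eq_one, Equiv.Perm.one_apply] at this
  exact this.symm

section Crystallographic

variable [P.IsCrystallographic]

theorem root_prod_reflectionPerm_of_pairwise {l : List ι}
    (hl : l.Pairwise fun j k ↦ P.pairingIn ℤ k j = 0) (i : ι) :
    P.root ((l.map P.reflectionPerm).prod i) =
      P.root i - (l.map fun j ↦ P.pairingIn ℤ i j • P.root j).sum := by
  induction l with
  | nil => simp
  | cons j l ih =>
    obtain ⟨hj, hl⟩ := List.pairwise_cons.mp hl
    have reflection_root_of_mem {k : ι} (hk : k ∈ l) : P.reflection j (P.root k) = P.root k := by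
      rw [P.reflection_apply_root' ℤ, hj k hk, zero_smul, sub_zero]
    have reflection_sum : P.reflection j (l.map fun k ↦ P.pairingIn ℤ i k • P.root k).sum =
        (l.map fun k ↦ P.pairingIn ℤ i k • P.root k).sum := by
      rw [map_list_sum, List.map_map]
      refine congrArg List.sum (List.map_congr_left fun k hk ↦ ?_)
      rw [Function.comp_apply, map_zsmul, reflection_root_of_mem hk]
    rw [List.map_cons, List.prod_cons, Equiv.Perm.mul_apply, P.root_reflectionPerm, ih hl, map_sub,
      reflection_sum, P.reflection_apply_root' ℤ, List.map_cons, List.sum_cons]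
    abel

variable {b : P.Base} [CharZero R] [Finite ι] [IsDomain R] [P.IsReduced]

/- The exchange argument: the sign change happens at some simple reflection of the product, which is
conjugate to the reflection in the `k`-th root and cancels against it. -/
theorem exists_prod_reflectionPerm_eq_of_not_isPos {l : List ι} (hl : ∀ i ∈ l, i ∈ b.support)
    {k : ι} (hk : k ∈ b.support) (hneg : ¬ b.IsPos ((l.map P.reflectionPerm).prod k)) :
    ∃ l' : List ι, (∀ i ∈ l', i ∈ b.support) ∧ l'.length < l.length ∧
      (l'.map P.reflectionPerm).prod = (l.map P.reflectionPerm).prod * P.reflectionPerm k := by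
  induction l with
  | nil => exact absurd (b.isPos_of_mem_support hk) hneg
  | cons j l ih =>
    obtain ⟨hj, hl⟩ := List.forall_mem_cons.mp hl
    by_cases hpos : b.IsPos ((l.map P.reflectionPerm).prod k)
    · have hkj : (l.map P.reflectionPerm).prod k = j := by
        by_contra hne
        exact hneg (hpos.reflectionPerm hj hne)
      have hconj := reflectionPerm_prod_reflectionPerm (P := P) l k
      refine ⟨l, hl, by simp, ?_⟩
      rw [List.map_cons, List.prod_cons, ← hkj, hconj, inv_mul_cancel_right, mul_assoc, ← pow_two,
        P.reflectionPerm_sq, mul_one]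
    · obtain ⟨l', hl', hlength, hprod⟩ := ih hl hpos
      exact ⟨j :: l', List.forall_mem_cons.mpr ⟨hj, hl'⟩, by simpa using hlength, by
        rw [List.map_cons, List.prod_cons, hprod, List.map_cons, List.prod_cons, mul_assoc]⟩

theorem prod_reflectionPerm_eq_one_of_isPos {l : List ι} (hl : ∀ i ∈ l, i ∈ b.support)
    (hpos : ∀ i, b.IsPos i → b.IsPos ((l.map P.reflectionPerm).prod i)) :
    (l.map P.reflectionPerm).prod = 1 := by
  induction hn : l.length using Nat.strong_induction_on generalizing l with
  | _ n ih =>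
    rcases l.eq_nil_or_concat' with rfl | ⟨l, k, rfl⟩
    · simp
    have hk : k ∈ b.support := hl k (by simp)
    replace hl : ∀ i ∈ l, i ∈ b.support := fun i hi ↦ hl i (by simp [hi])
    rw [List.map_append, List.prod_append, List.map_singleton, List.prod_singleton] at hpos ⊢
    have hneg : ¬ b.IsPos ((l.map P.reflectionPerm).prod k) := by
      have hk' := hpos k (b.isPos_of_mem_support hk)
      have hself : (l.map P.reflectionPerm).prod (P.reflectionPerm k k) =
          P.reflectionPerm ((l.map P.reflectionPerm).prod k)
            ((l.map P.reflectionPerm).prod k) := by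
        rw [reflectionPerm_prod_reflectionPerm]
        simp
      rw [Equiv.Perm.mul_apply, hself] at hk'
      exact (RootPairing.Base.IsPos.neg_iff_not b _).mp hk'
    obtain ⟨l', hl', hlength, hprod⟩ := exists_prod_reflectionPerm_eq_of_not_isPos hl hk hneg
    rw [← hprod] at hpos ⊢
    exact ih l'.length (by simp only [← hn, List.length_append]; omega) hl' hpos rfl

end Crystallographic

end WeylGroup

section RootLattice

variable {ι R M N : Type*} [CommRing R] [CharZero R] [AddCommGroup M] [Module R M]
  [AddCommGroup N] [Module R N] {P : RootPairing ι R M N} {V : Type*} [AddCommGroup V]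

/-- The homomorphism from the root lattice that takes prescribed values at the simple roots. -/
noncomputable def latticeLift (b : P.Base) (v : b.support → V) : P.rootSpan ℤ →+ V :=
  (b.toWeightBasisInt.constr ℤ v).toAddMonoidHom

theorem latticeLift_rootSpanMem (b : P.Base) (v : b.support → V) (k : b.support) :
    latticeLift b v (P.rootSpanMem ℤ k) = v k := by
  have : P.rootSpanMem ℤ (k : ι) = b.toWeightBasisInt k := by ext; simp
  rw [this]
  exact b.toWeightBasisInt.constr_basis ℤ v k

variable {b : P.Base} [P.IsCrystallographic]

theorem sum_pairingIn_smul_eq {w : b.support → V} {φ : P.rootSpan ℤ →+ V}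
    (h : ∀ k, ∑ j, b.cartanMatrix k j • w j = φ (P.rootSpanMem ℤ k)) (i : ι) :
    ∑ j : b.support, P.pairingIn ℤ i j • w j = φ (P.rootSpanMem ℤ i) := by
  have hext : ∑ j : b.support, (P.coroot'In ℤ j).smulRight (w j) = φ.toIntLinearMap := by
    refine b.toWeightBasisInt.ext fun k ↦ ?_
    have hk : b.toWeightBasisInt k = P.rootSpanMem ℤ (k : ι) := by ext; simp
    simp only [LinearMap.sum_apply, LinearMap.smulRight_apply, hk,
      P.coroot'In_rootSpanMem_eq_pairingIn (S := ℤ)]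
    exact h k
  have := LinearMap.congr_fun hext (P.rootSpanMem ℤ i)
  simp only [LinearMap.sum_apply, LinearMap.smulRight_apply,
    P.coroot'In_rootSpanMem_eq_pairingIn (S := ℤ)] at this
  exact this

variable [Finite ι] [IsDomain R]

theorem isPos_iff_of_pos {φ : P.rootSpan ℤ →+ ℝ}
    (hφ : ∀ k : b.support, 0 < φ (P.rootSpanMem ℤ k)) (i : ι) :
    b.IsPos i ↔ 0 < φ (P.rootSpanMem ℤ i) := by
  have pos_of_isPos {i : ι} (hi : b.IsPos i) : 0 < φ (P.rootSpanMem ℤ i) := by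
    refine hi.induction_on_add (p := fun i ↦ 0 < φ (P.rootSpanMem ℤ i)) (fun k hk ↦ hφ ⟨k, hk⟩)
      fun i j k hk hi hj ↦ ?_
    have : P.rootSpanMem ℤ k = P.rootSpanMem ℤ i + P.rootSpanMem ℤ j := Subtype.ext hk
    rw [this, map_add]
    exact add_pos hi (hφ ⟨j, hj⟩)
  refine ⟨pos_of_isPos, fun hi ↦ by_contra fun hneg ↦ ?_⟩
  have := pos_of_isPos ((RootPairing.Base.IsPos.or_neg b i).resolve_left hneg)
  rw [P.indexNeg_neg, P.rootSpanMem_reflectionPerm_self, map_neg] at this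
  linarith

/- A root `i` at which the linear extension of `y` is maximal pairs nonnegatively with all simple
coroots, because the simple reflections do not increase the value. -/
theorem pos_of_cartanMatrix_mulVec_eq [Nonempty ι] {y : b.support → ℝ} (hy : ∀ k, 0 < y k) {μ : ℝ}
    (h : ∀ k, ∑ j, b.cartanMatrix k j • y j = μ * y k) : 0 < μ := by
  let φ : P.rootSpan ℤ →+ ℝ := latticeLift b y
  have hφ (k : b.support) : φ (P.rootSpanMem ℤ k) = y k := latticeLift_rootSpanMem b y k
  obtain ⟨i, hi⟩ := Finite.exists_max fun i ↦ φ (P.rootSpanMem ℤ i)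
  have φ_pos : 0 < φ (P.rootSpanMem ℤ i) := by
    obtain ⟨k, hk⟩ := b.support_nonempty
    exact (hy ⟨k, hk⟩).trans_le ((hφ ⟨k, hk⟩).symm.trans_le (hi k))
  have pairing_nonneg (j : b.support) : 0 ≤ P.pairingIn ℤ i j := by
    have hrefl : P.rootSpanMem ℤ (P.reflectionPerm j i) =
        P.rootSpanMem ℤ i - P.pairingIn ℤ i j • P.rootSpanMem ℤ (j : ι) := by
      ext
      simp [P.root_reflectionPerm, P.reflection_apply_root' ℤ]
    have hle := hi (P.reflectionPerm j i)
    rw [hrefl, map_sub, map_zsmul, hφ, sub_le_self_iff, zsmul_eq_mul] at hle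
    exact_mod_cast nonneg_of_mul_nonneg_left hle (hy j)
  obtain ⟨j, hj, hij⟩ := b.exists_mem_support_pos_pairingIn_ne_zero i
  have hsum : ∑ j : b.support, P.pairingIn ℤ i j • y j = μ * φ (P.rootSpanMem ℤ i) :=
    sum_pairingIn_smul_eq (φ := (AddMonoidHom.mulLeft μ).comp φ)
      (fun k ↦ by rw [h, AddMonoidHom.comp_apply, hφ]; rfl) i
  have sum_pos : 0 < ∑ j : b.support, P.pairingIn ℤ i j • y j := by
    refine Finset.sum_pos' (fun k _ ↦ smul_nonneg (pairing_nonneg k) (hy k).le)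
      ⟨⟨j, hj⟩, Finset.mem_univ _, smul_pos ((pairing_nonneg ⟨j, hj⟩).lt_of_ne' ?_) (hy _)⟩
    have : Module.IsReflexive R M := .of_isPerfPair P.toLinearMap
    exact mt P.pairingIn_eq_zero_iff.mp hij
  exact pos_of_mul_pos_left (hsum ▸ sum_pos) φ_pos.le

end RootLattice

section CoxeterPlane

variable {ι R M N : Type*} [CommRing R] [AddCommGroup M] [Module R M]
  [AddCommGroup N] [Module R N] {P : RootPairing ι R M N} [P.IsCrystallographic]

/-- A bipartition of the Dynkin diagram together with a positive eigenvector of the Cartan matrix,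
whose eigenvalue is written as `2 - 2 cos θ` with `rotation = exp (iθ)`. These data determine a
projection of the root lattice onto the complex plane under which the product of the simple
reflections of each colour becomes a reflection of the plane, see `CoxeterPlane.proj`. -/
structure CoxeterPlane (b : P.Base) where
  color : (supportGraph b.cartanMatrix).Coloring Bool
  weight : b.support → ℝ
  weight_pos (k : b.support) : 0 < weight k
  rotation : ℂ
  norm_rotation : ‖rotation‖ = 1
  re_rotation_lt_one : rotation.re < 1
  sum_cartanMatrix_smul_weight (k : b.support) :
    ∑ j, b.cartanMatrix k j • weight j = (2 - 2 * rotation.re) * weight k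

namespace CoxeterPlane

variable {b : P.Base} (E : CoxeterPlane b)

/-- The unit vector along which the simple roots of a given colour are placed. -/
noncomputable def direction (a : Bool) : ℂ := if a then 1 else -E.rotation

/-- The simple roots of a given colour, in some order. -/
noncomputable def simpleRoots (a : Bool) : List ι :=
  (Finset.univ.filter (E.color · = a)).toList.map (↑)

/-- The permutation of the roots by the product of the simple reflections of a given colour. -/
noncomputable def halfCoxeter (a : Bool) : Equiv.Perm ι :=
  ((E.simpleRoots a).map P.reflectionPerm).prod

theorem norm_direction (a : Bool) : ‖E.direction a‖ = 1 := by
  cases a <;> simp [direction, E.norm_rotation]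

theorem re_conj_direction_mul_direction (a a' : Bool) :
    (starRingEnd ℂ (E.direction a) * E.direction a').re =
      if a' = a then 1 else -E.rotation.re := by
  have h : starRingEnd ℂ E.rotation * E.rotation = 1 := by
    rw [mul_comm, Complex.mul_conj', E.norm_rotation]; simp
  cases a <;> cases a' <;> simp [direction, h]

/-- The simple roots listed so that those of colour `true` come last. -/
noncomputable def orderedSimpleRoots : List ι :=
  E.simpleRoots false ++ E.simpleRoots true

/-- The permutation of the roots by the Coxeter element with the order of factors
`orderedSimpleRoots`. -/
noncomputable def coxeterPerm : Equiv.Perm ι :=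
  (E.orderedSimpleRoots.map P.reflectionPerm).prod

theorem mem_orderedSimpleRoots {i : ι} : i ∈ E.orderedSimpleRoots ↔ i ∈ b.support := by
  simp only [orderedSimpleRoots, simpleRoots, List.mem_append, List.mem_map, Finset.mem_toList,
    Finset.mem_filter, Finset.mem_univ, true_and]
  refine ⟨?_, fun hi ↦ ?_⟩
  · rintro (⟨j, -, rfl⟩ | ⟨j, -, rfl⟩) <;> exact j.2
  · cases h : E.color ⟨i, hi⟩
    exacts [.inl ⟨_, h, rfl⟩, .inr ⟨_, h, rfl⟩]

theorem nodup_orderedSimpleRoots : E.orderedSimpleRoots.Nodup := by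
  refine List.Nodup.append ((Finset.nodup_toList _).map Subtype.val_injective)
    ((Finset.nodup_toList _).map Subtype.val_injective) fun i h h' ↦ ?_
  simp only [simpleRoots, List.mem_map, Finset.mem_toList, Finset.mem_filter, Finset.mem_univ,
    true_and] at h h'
  obtain ⟨j, hj, rfl⟩ := h
  obtain ⟨k, hk, hkj⟩ := h'
  rw [Subtype.ext hkj, hj] at hk
  exact Bool.noConfusion hk

theorem rotation_ne_zero : E.rotation ≠ 0 :=
  norm_ne_zero_iff.mp (by simp [E.norm_rotation])

theorem exists_sign_forall_color_eq : ∃ s : Bool → ℤˣ, ∀ (a a' : Bool) (n : ℤ),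
    E.rotation ^ (2 * n) * s a • E.direction a = s a' • E.direction a' → a = a' := by
  obtain ⟨ε, hε⟩ := exists_sign_forall_zpow_ne E.rotation_ne_zero
  refine ⟨fun a ↦ if a then 1 else -ε, fun a a' n h ↦ ?_⟩
  cases a <;> cases a'
  · rfl
  · refine absurd ?_ (hε (-n))
    rw [mul_neg, zpow_neg]
    exact inv_eq_of_mul_eq_one_right (by simpa [direction] using h)
  · exact absurd (by simpa [direction] using h) (hε n)
  · rfl

variable [CharZero R]

/-- The projection of the root lattice onto the Coxeter plane. -/
noncomputable def proj : P.rootSpan ℤ →+ ℂ :=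
  latticeLift b fun k ↦ E.weight k * E.direction (E.color k)

theorem proj_rootSpanMem (k : b.support) :
    E.proj (P.rootSpanMem ℤ k) = E.weight k * E.direction (E.color k) :=
  latticeLift_rootSpanMem b _ k

theorem exists_injective_proj_eq_smul (ε : ℤˣ) : ∃ f : ι → ι, f.Injective ∧
    ∀ i, E.proj (P.rootSpanMem ℤ (f i)) = ε • E.proj (P.rootSpanMem ℤ i) := by
  rcases Int.units_eq_one_or ε with rfl | rfl
  · exact ⟨id, Function.injective_id, fun i ↦ by simp⟩
  · refine ⟨fun i ↦ P.reflectionPerm i i, fun i j h ↦ P.root.injective ?_, fun i ↦ ?_⟩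
    · simpa [P.root_reflectionPerm] using congrArg P.root h
    · rw [P.rootSpanMem_reflectionPerm_self, map_neg, Units.neg_smul, one_smul]

variable [IsDomain R]

theorem cartanMatrix_eq_zero {j k : b.support} (hne : j ≠ k) (hcolor : E.color j = E.color k) :
    b.cartanMatrix j k = 0 := by
  by_contra h
  exact E.color.valid ((supportGraph_adj_iff fun _ _ ↦
    b.cartanMatrix_apply_eq_zero_iff_symm.mp).mpr ⟨hne, h⟩) hcolor

theorem sum_cartanMatrix_smul_weight_color_eq (k : b.support) :
    ∑ j with E.color j = E.color k, b.cartanMatrix k j • E.weight j = 2 * E.weight k := by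
  rw [Finset.sum_eq_single_of_mem k (by simp), b.cartanMatrix_apply_same]
  · simp
  · intro j hj hne
    rw [E.cartanMatrix_eq_zero hne.symm (Finset.mem_filter.mp hj).2.symm, zero_smul]

theorem sum_cartanMatrix_smul_weight_color (a : Bool) (k : b.support) :
    ∑ j with E.color j = a, b.cartanMatrix k j • E.weight j =
      2 * (starRingEnd ℂ (E.direction a) * E.direction (E.color k)).re * E.weight k := by
  rw [re_conj_direction_mul_direction]
  split_ifs with h
  · rw [← h, sum_cartanMatrix_smul_weight_color_eq, mul_one]
  · have hsum := E.sum_cartanMatrix_smul_weight k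
    rw [← Finset.sum_filter_add_sum_filter_not _ (E.color · = E.color k),
      Finset.filter_congr (p := (¬ E.color · = E.color k)) (q := (E.color · = a)) fun j _ ↦ by
        rw [Bool.eq_not_of_ne h, Bool.eq_not, not_ne_iff],
      sum_cartanMatrix_smul_weight_color_eq] at hsum
    linear_combination hsum

theorem pairwise_simpleRoots (a : Bool) :
    (E.simpleRoots a).Pairwise fun j k ↦ P.pairingIn ℤ k j = 0 := by
  refine List.pairwise_map.mpr <| (Finset.nodup_toList _).imp_of_mem fun {j k} hj hk hne ↦ ?_
  simp only [Finset.mem_toList, Finset.mem_filter, Finset.mem_univ, true_and] at hj hk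
  exact E.cartanMatrix_eq_zero hne.symm (hk.trans hj.symm)

theorem proj_halfCoxeter (a : Bool) (i : ι) :
    E.proj (P.rootSpanMem ℤ (E.halfCoxeter a i)) =
      planeReflection (E.direction a) (E.proj (P.rootSpanMem ℤ i)) := by
  let w (j : b.support) : ℂ := if E.color j = a then E.weight j * E.direction a else 0
  have hsum : ∑ j : b.support, P.pairingIn ℤ i j • w j =
      E.proj (P.rootSpanMem ℤ i) -
        planeReflection (E.direction a) (E.proj (P.rootSpanMem ℤ i)) := by
    refine sum_pairingIn_smul_eq (b := b)
      (φ := E.proj - (planeReflection (E.direction a)).comp E.proj) (fun k ↦ ?_) i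
    have hk := congrArg (Complex.ofReal · * E.direction a)
      (E.sum_cartanMatrix_smul_weight_color a k)
    rw [AddMonoidHom.sub_apply, AddMonoidHom.comp_apply,
      sub_planeReflection_apply (E.norm_direction a), proj_rootSpanMem, mul_left_comm,
      Complex.re_ofReal_mul]
    simp only [w, smul_ite, smul_zero, ← Finset.sum_filter]
    convert hk using 1
    · simp [Finset.sum_mul, mul_assoc]
    · push_cast; ring
  have hroot : P.rootSpanMem ℤ (E.halfCoxeter a i) = P.rootSpanMem ℤ i -
      ((E.simpleRoots a).map fun j ↦ P.pairingIn ℤ i j • P.rootSpanMem ℤ j).sum := by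
    ext
    have := root_prod_reflectionPerm_of_pairwise (E.pairwise_simpleRoots a) i
    simpa [halfCoxeter, Function.comp_def, map_list_sum] using this
  rw [hroot, map_sub, sub_eq_iff_eq_add, ← sub_eq_iff_eq_add', ← hsum, simpleRoots, List.map_map,
    map_list_sum, List.map_map, Finset.sum_map_toList, Finset.sum_filter]
  refine Finset.sum_congr rfl fun j _ ↦ ?_
  simp only [w, Function.comp_apply, map_zsmul, proj_rootSpanMem]
  split_ifs with hj
  · rw [hj]
  · simp

theorem proj_coxeterPerm_pow (n : ℕ) (i : ι) :
    E.proj (P.rootSpanMem ℤ ((E.coxeterPerm ^ n) i)) =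
      E.rotation ^ (2 * n) * E.proj (P.rootSpanMem ℤ i) := by
  have coxeterPerm_eq : E.coxeterPerm = E.halfCoxeter false * E.halfCoxeter true := by
    rw [coxeterPerm, orderedSimpleRoots, List.map_append, List.prod_append]; rfl
  have proj_coxeterPerm (i : ι) : E.proj (P.rootSpanMem ℤ (E.coxeterPerm i)) =
      E.rotation ^ 2 * E.proj (P.rootSpanMem ℤ i) := by
    rw [coxeterPerm_eq, Equiv.Perm.mul_apply, proj_halfCoxeter, proj_halfCoxeter]
    exact planeReflection_planeReflection_one _ _
  induction n with
  | zero => simp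
  | succ n ih => rw [pow_succ', Equiv.Perm.mul_apply, proj_coxeterPerm, ih]; ring

variable [Finite ι]

theorem isPos_iff (i : ι) :
    b.IsPos i ↔ 0 < (E.proj (P.rootSpanMem ℤ i) * (1 - starRingEnd ℂ E.rotation)).re := by
  have h : E.rotation * starRingEnd ℂ E.rotation = 1 := by
    rw [Complex.mul_conj', E.norm_rotation]; simp
  refine isPos_iff_of_pos (φ := Complex.reAddGroupHom.comp
    ((AddMonoidHom.mulRight (1 - starRingEnd ℂ E.rotation)).comp E.proj)) (fun k ↦ ?_) i
  have hre : (E.direction (E.color k) * (1 - starRingEnd ℂ E.rotation)).re =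
      1 - E.rotation.re := by
    cases E.color k <;> simp [direction, mul_sub, h]; ring
  simp only [AddMonoidHom.comp_apply, AddMonoidHom.mulRight_apply, proj_rootSpanMem, mul_assoc,
    Complex.coe_reAddGroupHom, Complex.re_ofReal_mul, hre]
  exact mul_pos (E.weight_pos k) (sub_pos.mpr E.re_rotation_lt_one)

theorem coxeterPerm_pow_eq_one [P.IsReduced] {n : ℕ} (hn : E.rotation ^ (2 * n) = 1) :
    E.coxeterPerm ^ n = 1 := by
  have pow_eq : E.coxeterPerm ^ n =
      ((List.replicate n E.orderedSimpleRoots).flatten.map P.reflectionPerm).prod := by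
    simp [coxeterPerm]
  rw [pow_eq]
  refine prod_reflectionPerm_eq_one_of_isPos (b := b) (fun i hi ↦ ?_) fun i hi ↦ ?_
  · obtain ⟨l, hl, hil⟩ := List.mem_flatten.mp hi
    rw [List.eq_of_mem_replicate hl] at hil
    exact E.mem_orderedSimpleRoots.mp hil
  · rwa [← pow_eq, E.isPos_iff, proj_coxeterPerm_pow, hn, one_mul, ← E.isPos_iff]

theorem color_eq_and_coxeterPerm_pow_eq_one [P.IsReduced] {s : Bool → ℤˣ}
    (hs : ∀ (a a' : Bool) (n : ℤ),
      E.rotation ^ (2 * n) * s a • E.direction a = s a' • E.direction a' → a = a')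
    {k l : b.support} {i j : ι}
    (hi : E.proj (P.rootSpanMem ℤ i) = s (E.color k) • E.proj (P.rootSpanMem ℤ k))
    (hj : E.proj (P.rootSpanMem ℤ j) = s (E.color l) • E.proj (P.rootSpanMem ℤ l))
    {n : ℕ} (h : (E.coxeterPerm ^ n) i = j) : E.color k = E.color l ∧ E.coxeterPerm ^ n = 1 := by
  rw [proj_rootSpanMem, ← mul_smul_comm] at hi hj
  have hproj := E.proj_coxeterPerm_pow n i
  rw [h, hi, hj, mul_left_comm] at hproj
  have norm_units_smul (ε : ℤˣ) (z : ℂ) : ‖ε • z‖ = ‖z‖ := by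
    rcases Int.units_eq_one_or ε with rfl | rfl <;> simp
  have weight_eq : E.weight l = E.weight k := by
    simpa [norm_units_smul, E.norm_rotation, E.norm_direction, abs_of_pos (E.weight_pos _)]
      using congrArg norm hproj
  rw [weight_eq] at hproj
  replace hproj := mul_left_cancel₀ (Complex.ofReal_ne_zero.mpr (E.weight_pos k).ne') hproj
  have color_eq : E.color k = E.color l := hs _ _ n (by exact_mod_cast hproj.symm)
  refine ⟨color_eq, E.coxeterPerm_pow_eq_one ?_⟩
  rw [← color_eq] at hproj
  refine (mul_eq_right₀ (norm_ne_zero_iff.mp ?_)).mp hproj.symm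
  simp [norm_units_smul, E.norm_direction]

/- The orbits of the Coxeter element through the simple roots of one colour and through the simple
roots of the other colour, the latter with a suitable sign, are disjoint and of full length. -/
theorem card_support_mul_orderOf_coxeterPerm_le [P.IsReduced] :
    b.support.card * orderOf E.coxeterPerm ≤ Nat.card ι := by
  obtain ⟨s, hs⟩ := E.exists_sign_forall_color_eq
  choose f hf proj_f using fun a ↦ E.exists_injective_proj_eq_smul (s a)
  let orbit (x : b.support × Fin (orderOf E.coxeterPerm)) : ι :=
    (E.coxeterPerm ^ (x.2 : ℕ)) (f (E.color x.1) x.1)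
  have injective_orbit : orbit.Injective := by
    rintro ⟨k, i⟩ ⟨l, j⟩ h
    wlog hij : i ≤ j generalizing k l i j
    · exact (this l j k i h.symm (le_of_not_ge hij)).symm
    obtain ⟨n, hn⟩ : ∃ n : ℕ, (j : ℕ) = i + n := Nat.exists_eq_add_of_le hij
    simp only [orbit, hn, pow_add, Equiv.Perm.mul_apply, EmbeddingLike.apply_eq_iff_eq] at h
    obtain ⟨color_eq, pow_eq⟩ :=
      E.color_eq_and_coxeterPerm_pow_eq_one hs (proj_f _ l) (proj_f _ k) h.symm
    rw [pow_eq, Equiv.Perm.one_apply, color_eq] at h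
    have n_eq : n = 0 := Nat.eq_zero_of_dvd_of_lt (orderOf_dvd_of_pow_eq_one pow_eq) (by omega)
    exact Prod.ext (Subtype.ext (hf _ h)) (Fin.ext (by simp [hn, n_eq]))
  simpa [Nat.card_prod] using Nat.card_le_card_of_injective orbit injective_orbit

end CoxeterPlane

section Existence

variable {ι K M N : Type*} [Field K] [CharZero K] [AddCommGroup M] [Module K M] [AddCommGroup N]
  [Module K N] {P : RootPairing ι K M N} [Finite ι] [P.IsCrystallographic]

theorem isAcyclic_supportGraph_cartanMatrix [P.IsRootSystem] (b : P.Base) :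
    (supportGraph b.cartanMatrix).IsAcyclic := by
  classical
  obtain ⟨d, hd, hA⟩ := b.exists_cartanMatrix_mul_diagaonal_posDef
  exact fun _ _ hp ↦ not_posDef_mul_diagonal_of_isCycle hd b.cartanMatrix_apply_same
    b.cartanMatrix_le_zero_of_ne (fun _ _ ↦ b.cartanMatrix_apply_eq_zero_iff_symm.mp) hp hA

variable [P.IsReduced] [P.IsIrreducible]

theorem preconnected_supportGraph_cartanMatrix (b : P.Base) :
    (supportGraph b.cartanMatrix).Preconnected := by
  intro i j
  refine b.induction_on_cartanMatrix ((supportGraph b.cartanMatrix).Reachable i) .rfl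
    fun k l hk hlk ↦ ?_
  rcases eq_or_ne l k with rfl | hne
  · exact hk
  · exact hk.trans (SimpleGraph.Adj.reachable <| ((supportGraph_adj_iff fun _ _ ↦
      b.cartanMatrix_apply_eq_zero_iff_symm.mp).mpr ⟨hne, hlk⟩).symm)

theorem exists_pos_sum_cartanMatrix_smul_eq [Nonempty ι] (b : P.Base) :
    ∃ (c : ℝ) (y : b.support → ℝ), 0 ≤ c ∧ (∀ k, 0 < y k) ∧
      ∀ k, ∑ j, b.cartanMatrix k j • y j = (2 - c) * y k := by
  classical
  obtain ⟨d, hd, hA⟩ := b.exists_cartanMatrix_mul_diagaonal_posDef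
  have : Nonempty b.support := b.support_nonempty.to_subtype
  let B : Matrix b.support b.support ℝ := .of fun i j ↦ if i = j then 0 else -b.cartanMatrix i j
  have B_of_ne {i j} (h : i ≠ j) : B i j = -b.cartanMatrix i j := if_neg h
  have B_self (i) : B i i = 0 := if_pos rfl
  have B_eq_zero_iff {i j} (h : i ≠ j) : B i j = 0 ↔ b.cartanMatrix i j = 0 := by simp [B_of_ne h]
  have B_nonneg (i j) : 0 ≤ B i j := by
    rcases eq_or_ne i j with rfl | h
    · exact (B_self i).ge
    · simpa [B_of_ne h] using b.cartanMatrix_le_zero_of_ne i j h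
  have B_symm (i j) : B i j * d j = B j i * d i := by
    rcases eq_or_ne i j with rfl | h
    · rfl
    · have := hA.isHermitian.apply j i
      simp only [Matrix.mul_diagonal, star_trivial] at this
      rw [B_of_ne h, B_of_ne h.symm]
      exact_mod_cast (by linarith : -b.cartanMatrix i j * d j = -b.cartanMatrix j i * d i)
  have supportGraph_B : supportGraph B = supportGraph b.cartanMatrix := by
    ext i j
    simp only [supportGraph, SimpleGraph.fromRel_adj]
    exact and_congr_right fun h ↦ by rw [Ne, Ne, B_eq_zero_iff h, B_eq_zero_iff h.symm]
  obtain ⟨c, y, hc, hy, hBy⟩ :=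
    exists_pos_mulVec_eq_smul (fun i ↦ Int.cast_pos.mpr (hd i)) B_symm B_nonneg
      (supportGraph_B ▸ preconnected_supportGraph_cartanMatrix b)
  refine ⟨c, y, hc, hy, fun k ↦ ?_⟩
  have hk : ∑ j, B k j * y j = c * y k := congrFun hBy k
  rw [sub_mul, ← hk, eq_sub_iff_add_eq, ← Finset.sum_add_distrib, Finset.sum_eq_single k]
  · simp [B_self]
  · intro j _ hj
    simp [B_of_ne hj.symm]
  · simp

theorem nonempty_coxeterPlane [Nonempty ι] (b : P.Base) : Nonempty (CoxeterPlane b) := by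
  obtain ⟨c, y, hc, hy, heig⟩ := exists_pos_sum_cartanMatrix_smul_eq b
  have hc' : c < 2 := sub_pos.mp (pos_of_cartanMatrix_mulVec_eq hy heig)
  have cos_eq : Real.cos (Real.arccos (c / 2)) = c / 2 :=
    Real.cos_arccos (by linarith) (by linarith)
  exact ⟨{
    color := (isAcyclic_supportGraph_cartanMatrix b).colorable_two.toColoring (by simp)
    weight := y
    weight_pos := hy
    rotation := Complex.exp (Real.arccos (c / 2) * Complex.I)
    norm_rotation := Complex.norm_exp_ofReal_mul_I _
    re_rotation_lt_one := by rw [Complex.exp_ofReal_mul_I_re, cos_eq]; linarith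
    sum_cartanMatrix_smul_weight := fun k ↦ by
      rw [heig, Complex.exp_ofReal_mul_I_re, cos_eq]; ring }⟩

theorem exists_card_support_mul_orderOf_le [Nonempty ι] (b : P.Base) :
    ∃ l : List ι, l.Nodup ∧ (∀ i, i ∈ l ↔ i ∈ b.support) ∧
      b.support.card * orderOf (l.map P.reflection).prod ≤ Nat.card ι := by
  obtain ⟨E⟩ := nonempty_coxeterPlane b
  have orderOf_le : orderOf (E.orderedSimpleRoots.map P.reflection).prod ≤
      orderOf E.coxeterPerm :=
    Nat.le_of_dvd (orderOf_pos _) (orderOf_prod_reflection_dvd _)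
  exact ⟨E.orderedSimpleRoots, E.nodup_orderedSimpleRoots, fun _ ↦ E.mem_orderedSimpleRoots,
    (Nat.mul_le_mul_left _ orderOf_le).trans E.card_support_mul_orderOf_coxeterPerm_le⟩

end Existence

end CoxeterPlane

section LinearAlgebra

open Module

variable {K V ι : Type*} [Field K] [AddCommGroup V] [Module K V]

theorem eqLocus_one_eq_iSup (T : End K V) {W : ι → Submodule K V} (iSup_eq_top : ⨆ i, W i = ⊤)
    {c : ι → K} (hT : ∀ i, ∀ v ∈ W i, T v = c i • v) :
    LinearMap.eqLocus T (1 : End K V) = ⨆ i : {i // c i = 1}, W i := by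
  have le_eigenspace (i : ι) : W i ≤ T.eigenspace (c i) := fun v hv ↦
    End.mem_eigenspace_iff.mpr (hT i v hv)
  have eqLocus_eq : LinearMap.eqLocus T (1 : End K V) = T.eigenspace 1 := by
    ext v
    rw [LinearMap.mem_eqLocus, End.mem_eigenspace_iff, one_smul, End.one_apply]
  have fixed_le : ⨆ i : {i // c i = 1}, W i ≤ T.eigenspace 1 :=
    iSup_le fun i ↦ (le_eigenspace i).trans_eq (by rw [i.2])
  have moved_le : ⨆ i : {i // c i ≠ 1}, W i ≤ ⨆ (μ : K) (_ : μ ≠ 1), T.eigenspace μ :=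
    iSup_le fun i ↦ le_iSup₂_of_le (c i) i.2 (le_eigenspace i)
  have sup_eq_top : (⨆ i : {i // c i = 1}, W i) ⊔ ⨆ i : {i // c i ≠ 1}, W i = ⊤ := by
    rw [← iSup_eq_top, iSup_subtype, iSup_subtype, iSup_split W (fun i ↦ c i = 1)]
  have disjoint_moved : Disjoint (⨆ i : {i // c i ≠ 1}, W i) (T.eigenspace 1) :=
    (T.eigenspaces_iSupIndep 1).symm.mono_left moved_le
  rw [eqLocus_eq, ← inf_of_le_right (le_top : T.eigenspace 1 ≤ ⊤), ← sup_eq_top,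
    sup_inf_assoc_of_le _ fixed_le, disjoint_moved.eq_bot, sup_bot_eq]

variable [FiniteDimensional K V]

theorem finrank_sup_le_sum (s : Finset ι) (W : ι → Submodule K V) :
    finrank K ↥(s.sup W) ≤ ∑ i ∈ s, finrank K (W i) := by
  classical
  induction s using Finset.induction_on with
  | empty => simp
  | insert i s hi ih =>
    rw [Finset.sup_insert, Finset.sum_insert hi]
    exact (Submodule.finrank_add_le_finrank_add_finrank _ _).trans (Nat.add_le_add_left ih _)

theorem finrank_sup_eq_sum {s : Finset ι} {W : ι → Submodule K V} (hW : s.SupIndep W) :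
    finrank K ↥(s.sup W) = ∑ i ∈ s, finrank K (W i) := by
  classical
  induction s using Finset.induction_on with
  | empty => simp
  | insert i s hi ih =>
    have disjoint : Disjoint (W i) (s.sup W) :=
      hW (Finset.subset_insert i s) (Finset.mem_insert_self i s) hi
    have := Submodule.finrank_sup_add_finrank_inf_eq (W i) (s.sup W)
    rw [disjoint.eq_bot, finrank_bot, add_zero, ih (hW.subset (Finset.subset_insert i s))] at this
    rw [Finset.sup_insert, Finset.sum_insert hi, this]

theorem sum_finrank_le_of_iSupIndep {W : ι → Submodule K V} (hW : iSupIndep W) (s : Finset ι)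
    {U : Submodule K V} (hU : ∀ i ∈ s, W i ≤ U) : ∑ i ∈ s, finrank K (W i) ≤ finrank K U :=
  (finrank_sup_eq_sum (hW.supIndep' s)).symm.trans_le (Submodule.finrank_mono (Finset.sup_le hU))

theorem finrank_iSup_le_finrank_iSup {W W' : ι → Submodule K V} (hW' : iSupIndep W')
    (hle : ∀ i, finrank K (W i) ≤ finrank K (W' i)) :
    finrank K ↥(⨆ i, W i) ≤ finrank K ↥(⨆ i, W' i) := by
  have hfin : {i | W' i ≠ ⊥}.Finite := WellFoundedGT.finite_ne_bot_of_iSupIndep hW'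
  have iSup_le_sup : ⨆ i, W i ≤ hfin.toFinset.sup W := iSup_le fun i ↦ by
    by_cases hi : W' i = ⊥
    · have hWi : finrank K (W i) ≤ 0 := (hle i).trans_eq (by rw [hi, finrank_bot])
      simp [Submodule.finrank_eq_zero.mp (Nat.le_zero.mp hWi)]
    · exact Finset.le_sup (f := W) (by simpa using hi)
  calc finrank K ↥(⨆ i, W i)
    _ ≤ finrank K ↥(hfin.toFinset.sup W) := Submodule.finrank_mono iSup_le_sup
    _ ≤ ∑ i ∈ hfin.toFinset, finrank K (W i) := finrank_sup_le_sum _ W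
    _ ≤ ∑ i ∈ hfin.toFinset, finrank K (W' i) := Finset.sum_le_sum fun i _ ↦ hle i
    _ ≤ finrank K ↥(⨆ i, W' i) := sum_finrank_le_of_iSupIndep hW' _ fun i _ ↦ le_iSup W' i

theorem exists_forall_le_eq_bot_of_iSupIndep {W : ℕ → Submodule K V} (hW : iSupIndep W) :
    ∃ N, ∀ n, N ≤ n → W n = ⊥ := by
  obtain ⟨N, hN⟩ := (WellFoundedGT.finite_ne_bot_of_iSupIndep hW).bddAbove
  refine ⟨N + 1, fun n hn ↦ ?_⟩
  by_contra hne
  exact (hN hne).not_gt hn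

theorem finrank_le_finrank_ker_inf_add (T : End K V) {U U' : Submodule K V}
    (hT : ∀ v ∈ U, T v ∈ U') :
    finrank K U ≤ finrank K ↥(LinearMap.ker T ⊓ U) + finrank K U' := by
  have rank_nullity := (T.domRestrict U).finrank_range_add_finrank_ker
  have range_le : LinearMap.range (T.domRestrict U) ≤ U' := by
    rintro _ ⟨v, rfl⟩
    exact hT v v.2
  have ker_le : (LinearMap.ker (T.domRestrict U)).map U.subtype ≤ LinearMap.ker T ⊓ U := by
    rintro _ ⟨v, hv, rfl⟩
    exact ⟨hv, v.2⟩
  have finrank_ker_le := Submodule.finrank_mono ker_le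
  rw [Submodule.finrank_map_subtype_eq] at finrank_ker_le
  have finrank_range_le := Submodule.finrank_mono range_le
  omega

theorem isNilpotent_of_forall_apply_mem_add {W : ℤ → Submodule K V} (hW : iSupIndep W)
    (iSup_eq_top : ⨆ j, W j = ⊤) {k : ℤ} (hk : k ≠ 0) {T : End K V}
    (hT : ∀ j, ∀ v ∈ W j, T v ∈ W (j + k)) : IsNilpotent T := by
  suffices ⊤ ≤ T.maxGenEigenspace 0 by
    rw [End.isNilpotent_iff_of_finite]
    intro v
    simpa [End.mem_maxGenEigenspace] using this (Submodule.mem_top (x := v))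
  rw [← iSup_eq_top]
  refine iSup_le fun j v hv ↦ ?_
  have pow_mem (n : ℕ) : (T ^ n) v ∈ W (j + n * k) := by
    induction n with
    | zero => simpa using hv
    | succ n ih =>
      rw [pow_succ', End.mul_apply, Nat.cast_add_one, add_one_mul, ← add_assoc]
      exact hT _ _ ih
  obtain ⟨n, hn⟩ : ∃ n : ℕ, W (j + n * k) = ⊥ := by
    by_contra! hne
    refine Set.infinite_of_injective_forall_mem (s := {j | W j ≠ ⊥}) (fun a b hab ↦ ?_) hne
      (WellFoundedGT.finite_ne_bot_of_iSupIndep hW)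
    simpa [hk] using hab
  rw [End.mem_maxGenEigenspace]
  exact ⟨n, by simpa [hn] using pow_mem n⟩

theorem exists_forall_apply_eq_smul_of_mem_eigenspace (T : End K V) (g : K → K) :
    ∃ S : End K V, ∀ μ, ∀ v ∈ T.eigenspace μ, S v = g μ • v := by
  classical
  have hfin : {μ | T.eigenspace μ ≠ ⊥}.Finite :=
    WellFoundedGT.finite_ne_bot_of_iSupIndep T.eigenspaces_iSupIndep
  refine ⟨Polynomial.aeval T (Lagrange.interpolate hfin.toFinset id g), fun μ v hv ↦ ?_⟩
  rcases eq_or_ne v 0 with rfl | hv0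
  · simp
  have hμ : μ ∈ hfin.toFinset :=
    hfin.mem_toFinset.mpr ((Submodule.ne_bot_iff _).mpr ⟨v, hv, hv0⟩)
  have eval_eq : (Lagrange.interpolate hfin.toFinset id g).eval μ = g μ :=
    Lagrange.eval_interpolate_at_node (v := id) g (Set.injOn_id _) hμ
  rw [End.aeval_apply_of_hasEigenvector ⟨hv, hv0⟩, eval_eq]

theorem pow_finrank_eq_zero_of_isNilpotent {T : End K V} (hT : IsNilpotent T) :
    T ^ finrank K V = 0 := by
  have := T.aeval_self_charpoly
  rwa [IsNilpotent.charpoly_eq_X_pow_finrank hT, map_pow, Polynomial.aeval_X] at this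

omit [FiniteDimensional K V] in
theorem maxGenEigenspace_neg (T : End K V) (μ : K) :
    (-T).maxGenEigenspace (-μ) = T.maxGenEigenspace μ := by
  ext v
  rw [End.mem_maxGenEigenspace, End.mem_maxGenEigenspace]
  refine exists_congr fun k ↦ ?_
  have neg_sub_neg_smul : -T - -μ • (1 : End K V) = -(T - μ • 1) := by rw [neg_smul]; abel
  rw [neg_sub_neg_smul, neg_pow, End.mul_apply]
  rcases neg_one_pow_eq_or (End K V) k with hk | hk <;> simp [hk]

end LinearAlgebra

section Sl2Modules

open Module LieModule

variable {F L : Type*} (V : Type*) [Field F] [LieRing L] [LieAlgebra F L]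
  [AddCommGroup V] [Module F V] [LieRingModule L V] [LieModule F L V] {h e f : L}

variable {V} in
theorem lie_e_mem_maxGenEigenspace (t : IsSl2Triple h e f) {μ : F} {v : V}
    (hv : v ∈ (toEnd F L V h).maxGenEigenspace μ) :
    ⁅e, v⁆ ∈ (toEnd F L V h).maxGenEigenspace (μ + 2) := by
  rw [add_comm]
  refine lie_mem_maxGenEigenspace_toEnd (End.eigenspace_le_maxGenEigenspace ?_) hv
  rw [End.mem_eigenspace_iff, toEnd_apply_apply, t.lie_h_e_smul F]

/-- The multiplicity of `μ` as a generalized weight of `h` on `V`, that is, the dimension of the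
generalized eigenspace. It is used for the semisimple element `h` of an `sl₂`-triple. -/
noncomputable def weightMultiplicity (h : L) (μ : F) : ℕ :=
  finrank F ((toEnd F L V h).maxGenEigenspace μ)

variable {V} in
theorem weightMultiplicity_neg (μ : F) :
    weightMultiplicity V (-h) (-μ) = weightMultiplicity V h μ := by
  rw [weightMultiplicity, map_neg, maxGenEigenspace_neg, weightMultiplicity]

variable [FiniteDimensional F V]

variable {V} in
theorem weightMultiplicity_eq_zero {μ : F} :
    weightMultiplicity V h μ = 0 ↔ (toEnd F L V h).maxGenEigenspace μ = ⊥ :=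
  Submodule.finrank_eq_zero

theorem exists_forall_le_weightMultiplicity_eq_zero {g : ℕ → F} (hg : g.Injective) :
    ∃ N, ∀ n, N ≤ n → weightMultiplicity V h (g n) = 0 := by
  simp only [weightMultiplicity_eq_zero]
  exact exists_forall_le_eq_bot_of_iSupIndep
    ((toEnd F L V h).independent_maxGenEigenspace.comp hg)

theorem weightMultiplicity_le_finrank_ker_inf_add (t : IsSl2Triple h e f) (μ : F) :
    weightMultiplicity V h μ ≤
      finrank F ↥(LinearMap.ker (toEnd F L V e) ⊓ (toEnd F L V h).maxGenEigenspace μ) +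
        weightMultiplicity V h (μ + 2) :=
  finrank_le_finrank_ker_inf_add _ fun _ hv ↦ lie_e_mem_maxGenEigenspace t hv

variable [CharZero F]

variable {V} in
/- The last nonzero `(h - μ)ᵏ v` is an honest eigenvector of `h`, still killed by `e`. -/
theorem exists_nat_of_lie_e_eq_zero (t : IsSl2Triple h e f) {μ : F} {v : V}
    (hv : v ∈ (toEnd F L V h).maxGenEigenspace μ) (hv0 : v ≠ 0) (hev : ⁅e, v⁆ = 0) :
    ∃ n : ℕ, μ = n := by
  obtain ⟨k, hk⟩ := (End.mem_maxGenEigenspace _ _ _).mp hv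
  set T : End F V := toEnd F L V h - μ • 1
  have T_apply (w : V) : T w = ⁅h, w⁆ - μ • w := rfl
  have lie_e_pow (n : ℕ) : ⁅e, (T ^ n) v⁆ = 0 := by
    induction n with
    | zero => simpa using hev
    | succ n ih =>
      rw [pow_succ', End.mul_apply, T_apply, lie_sub, lie_smul, ih, smul_zero, sub_zero,
        leibniz_lie, ih, lie_zero, add_zero, ← lie_skew, t.lie_h_e_smul F, neg_lie, smul_lie, ih,
        smul_zero, neg_zero]
  obtain ⟨n, pow_ne_zero, pow_succ_eq_zero⟩ := Nat.exists_not_and_succ_of_not_zero_of_exists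
    (p := fun n ↦ (T ^ n) v = 0) (by simpa using hv0) ⟨k, hk⟩
  rw [pow_succ', End.mul_apply, T_apply, sub_eq_zero] at pow_succ_eq_zero
  exact IsSl2Triple.HasPrimitiveVectorWith.exists_nat (t := t)
    ⟨pow_ne_zero, pow_succ_eq_zero, lie_e_pow n⟩

theorem weightMultiplicity_le_add_two (t : IsSl2Triple h e f) {μ : F} (hμ : ∀ n : ℕ, μ ≠ n) :
    weightMultiplicity V h μ ≤ weightMultiplicity V h (μ + 2) := by
  have ker_inf_eq_bot :
      LinearMap.ker (toEnd F L V e) ⊓ (toEnd F L V h).maxGenEigenspace μ = ⊥ := by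
    refine (Submodule.eq_bot_iff _).mpr fun v ⟨hev, hv⟩ ↦ ?_
    by_contra hv0
    obtain ⟨n, hn⟩ := exists_nat_of_lie_e_eq_zero t hv hv0 hev
    exact hμ n hn
  have := weightMultiplicity_le_finrank_ker_inf_add V t μ
  rwa [ker_inf_eq_bot, finrank_bot, zero_add] at this

theorem weightMultiplicity_le_sub_two (t : IsSl2Triple h e f) {μ : F} (hμ : ∀ n : ℕ, μ ≠ -n) :
    weightMultiplicity V h μ ≤ weightMultiplicity V h (μ - 2) := by
  rw [← weightMultiplicity_neg, ← weightMultiplicity_neg (μ - 2), neg_sub', sub_neg_eq_add]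
  exact weightMultiplicity_le_add_two V t.symm fun n hn ↦ hμ n (by rw [← hn, neg_neg])

theorem weightMultiplicity_zero_add_one_le_sum (t : IsSl2Triple h e f) (N : ℕ) :
    weightMultiplicity V h (0 : F) + weightMultiplicity V h (1 : F) ≤
      ∑ n ∈ Finset.range N,
        finrank F ↥(LinearMap.ker (toEnd F L V e) ⊓ (toEnd F L V h).maxGenEigenspace (n : F)) +
      weightMultiplicity V h (N : F) + weightMultiplicity V h (N + 1 : F) := by
  induction N with
  | zero => simp
  | succ N ih =>
    have := weightMultiplicity_le_finrank_ker_inf_add V t (N : F)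
    rw [Finset.sum_range_succ, Nat.cast_add_one, show (N + 1 + 1 : F) = N + 2 by ring]
    omega

/- Every irreducible constituent has a one-dimensional space of vectors killed by `e`, and exactly
one of the weights zero and one. -/
theorem weightMultiplicity_zero_add_one_le_finrank_ker (t : IsSl2Triple h e f) :
    weightMultiplicity V h (0 : F) + weightMultiplicity V h (1 : F) ≤
      finrank F (LinearMap.ker (toEnd F L V e)) := by
  obtain ⟨N, hN⟩ := exists_forall_le_weightMultiplicity_eq_zero V (h := h)
    (Nat.cast_injective (R := F))
  have le_sum := weightMultiplicity_zero_add_one_le_sum (F := F) V t N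
  rw [hN N le_rfl, ← Nat.cast_add_one, hN (N + 1) N.le_succ, add_zero, add_zero] at le_sum
  have indep : iSupIndep fun n : ℕ ↦ (toEnd F L V h).maxGenEigenspace (n : F) :=
    (toEnd F L V h).independent_maxGenEigenspace.comp Nat.cast_injective
  exact le_sum.trans <|
    sum_finrank_le_of_iSupIndep (indep.mono fun _ ↦ inf_le_right) _ fun _ _ ↦ inf_le_left

theorem weightMultiplicity_add_two_mul_le (t : IsSl2Triple h e f) (i k : ℕ) :
    weightMultiplicity V h (i + 2 * k : F) ≤ weightMultiplicity V h (i : F) := by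
  induction k with
  | zero => simp
  | succ k ih =>
    refine le_trans ?_ ih
    have ne_neg (n : ℕ) : (i + 2 * (k + 1 : ℕ) : F) ≠ -n := fun hn ↦ by
      rw [← add_eq_zero_iff_eq_neg] at hn
      norm_cast at hn
      omega
    have := weightMultiplicity_le_sub_two V t ne_neg
    rwa [show (i + 2 * (k + 1 : ℕ) - 2 : F) = i + 2 * k by push_cast; ring] at this

theorem weightMultiplicity_neg_add_two_mul_le (t : IsSl2Triple h e f) (i k : ℕ) :
    weightMultiplicity V h (-(i + 2 * k) : F) ≤ weightMultiplicity V h (-i : F) := by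
  rw [← weightMultiplicity_neg, ← weightMultiplicity_neg (-i : F), neg_neg, neg_neg]
  exact weightMultiplicity_add_two_mul_le V t.symm i k

theorem weightMultiplicity_two_mul_le (t : IsSl2Triple h e f) {i j : ℤ}
    (hij : (0 ≤ i ∧ i ≤ j) ∨ (j ≤ i ∧ i ≤ 0)) :
    weightMultiplicity V h (2 * j : F) ≤ weightMultiplicity V h (2 * i : F) := by
  rcases hij with ⟨hi, hij⟩ | ⟨hji, hi⟩
  · obtain ⟨a, rfl⟩ := Int.eq_ofNat_of_zero_le hi
    obtain ⟨k, rfl⟩ := Int.le.dest hij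
    simpa [mul_add] using weightMultiplicity_add_two_mul_le (F := F) V t (2 * a) k
  · obtain ⟨a, ha⟩ := Int.eq_ofNat_of_zero_le (neg_nonneg.mpr hi)
    obtain rfl : i = -a := by omega
    obtain ⟨k, hk⟩ := Int.le.dest hji
    obtain rfl : j = -(a + k) := by omega
    have := weightMultiplicity_neg_add_two_mul_le (F := F) V t (2 * a) k
    push_cast at this ⊢
    rwa [mul_neg, mul_neg, mul_add]

/- Unless `μ` is an integer, `e` is injective on the weight spaces for all the weights `μ + 2n`. -/
theorem exists_int_of_weightMultiplicity_ne_zero (t : IsSl2Triple h e f) {μ : F}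
    (hμ : weightMultiplicity V h μ ≠ 0) : ∃ k : ℤ, μ = k := by
  by_contra! not_int
  have le_add (n : ℕ) : weightMultiplicity V h μ ≤ weightMultiplicity V h (μ + 2 * n) := by
    induction n with
    | zero => simp
    | succ n ih =>
      have := weightMultiplicity_le_add_two V t (μ := μ + 2 * n) fun k hk ↦
        not_int (k - 2 * n) (by push_cast; rw [← hk]; ring)
      rw [Nat.cast_add_one, mul_add_one, ← add_assoc]
      exact ih.trans this
  obtain ⟨N, hN⟩ := exists_forall_le_weightMultiplicity_eq_zero V (h := h)
    (g := fun n : ℕ ↦ μ + 2 * n) fun a b hab ↦ by simpa using hab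
  exact hμ (Nat.le_zero.mp ((le_add N).trans_eq (hN N le_rfl)))

theorem weightMultiplicity_odd_eq_zero (t : IsSl2Triple h e f)
    (weight_one : weightMultiplicity V h (1 : F) = 0) (j : ℤ) :
    weightMultiplicity V h (2 * j + 1 : F) = 0 := by
  rcases le_or_gt 0 j with hj | hj
  · obtain ⟨a, rfl⟩ := Int.eq_ofNat_of_zero_le hj
    have := weightMultiplicity_add_two_mul_le (F := F) V t 1 a
    rw [Int.cast_natCast, add_comm]
    rwa [Nat.cast_one, weight_one, Nat.le_zero] at this
  · obtain ⟨a, ha⟩ := Int.eq_ofNat_of_zero_le (show 0 ≤ -j - 1 by omega)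
    obtain rfl : j = -a - 1 := by omega
    have neg_one_le := weightMultiplicity_le_add_two V t (μ := (-1 : F)) fun n hn ↦
      n.cast_add_one_ne_zero (R := F) (by rw [← hn, neg_add_cancel])
    rw [show (-1 + 2 : F) = 1 by ring, weight_one] at neg_one_le
    have := weightMultiplicity_neg_add_two_mul_le (F := F) V t 1 a
    rw [Nat.cast_one] at this
    rw [show (2 * (-a - 1 : ℤ) + 1 : F) = -(1 + 2 * a) by push_cast; ring]
    exact Nat.le_zero.mp (this.trans neg_one_le)

theorem exists_two_mul_of_weightMultiplicity_ne_zero (t : IsSl2Triple h e f)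
    (weight_one : weightMultiplicity V h (1 : F) = 0) {μ : F}
    (hμ : weightMultiplicity V h μ ≠ 0) : ∃ j : ℤ, μ = 2 * j := by
  obtain ⟨k, rfl⟩ := exists_int_of_weightMultiplicity_ne_zero V t hμ
  rcases Int.even_or_odd' k with ⟨j, rfl | rfl⟩
  · exact ⟨j, by push_cast; rfl⟩
  · refine (hμ ?_).elim
    push_cast
    exact weightMultiplicity_odd_eq_zero V t weight_one j

theorem finrank_le_mul_weightMultiplicity_zero [IsAlgClosed F] (t : IsSl2Triple h e f) {n : ℕ}
    (hn : ∀ μ : F, weightMultiplicity V h μ ≠ 0 → ∃ j : ℤ, |j| ≤ n ∧ μ = 2 * j) :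
    finrank F V ≤ (2 * n + 1) * weightMultiplicity V h (0 : F) := by
  let W (j : ℤ) : Submodule F V := (toEnd F L V h).maxGenEigenspace (2 * j : F)
  have top_le_sup : ⊤ ≤ (Finset.Icc (-n : ℤ) n).sup W := by
    rw [← (toEnd F L V h).iSup_maxGenEigenspace_eq_top]
    refine iSup_le fun μ ↦ ?_
    by_cases hμ : weightMultiplicity V h μ = 0
    · exact (weightMultiplicity_eq_zero.mp hμ).trans_le bot_le
    · obtain ⟨j, hj, rfl⟩ := hn μ hμ
      exact Finset.le_sup (f := W) (Finset.mem_Icc.mpr (abs_le.mp hj))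
  have multiplicity_le (j : ℤ) :
      weightMultiplicity V h (2 * j : F) ≤ weightMultiplicity V h (0 : F) := by
    simpa using weightMultiplicity_two_mul_le (F := F) V t (i := 0) (j := j)
      ((le_total 0 j).imp (fun hj ↦ ⟨le_rfl, hj⟩) fun hj ↦ ⟨hj, le_rfl⟩)
  have card_Icc : (Finset.Icc (-n : ℤ) n).card = 2 * n + 1 := by
    rw [Int.card_Icc]
    omega
  calc finrank F V = finrank F (⊤ : Submodule F V) := (finrank_top F V).symm
    _ ≤ finrank F ↥((Finset.Icc (-n : ℤ) n).sup W) := Submodule.finrank_mono top_le_sup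
    _ ≤ ∑ j ∈ Finset.Icc (-n : ℤ) n, finrank F (W j) := finrank_sup_le_sum _ W
    _ ≤ (Finset.Icc (-n : ℤ) n).card • weightMultiplicity V h (0 : F) :=
      Finset.sum_le_card_nsmul _ _ _ fun j _ ↦ multiplicity_le j
    _ = (2 * n + 1) * weightMultiplicity V h (0 : F) := by rw [card_Icc, smul_eq_mul]

end Sl2Modules

section ExpAd

open Module LieAlgebra

variable {F L : Type*} [Field F] [LieRing L] [LieAlgebra F L] [FiniteDimensional F L]

theorem expAd_apply_eq_sum {x y : L} {n : ℕ} (hn : (ad F L x ^ n) y = 0) :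
    expAd F x y = ∑ k ∈ Finset.range n, (k.factorial : F)⁻¹ • (ad F L x ^ k) y := by
  have pow_finrank : (ad F L x ^ finrank F L) y = 0 :=
    End.ker_pow_le_ker_pow_finrank (ad F L x : End F L) n hn
  have term_eq_zero {m : ℕ} (hm : (ad F L x ^ m) y = 0) (k : ℕ) (hk : m ≤ k) :
      (k.factorial : F)⁻¹ • (ad F L x ^ k) y = 0 := by
    rw [End.pow_map_zero_of_le hk hm, smul_zero]
  calc expAd F x y
      = ∑ k ∈ Finset.range (finrank F L), (k.factorial : F)⁻¹ • (ad F L x ^ k) y := by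
        simp [expAd, LinearMap.sum_apply]
    _ = ∑ k ∈ Finset.range (max (finrank F L) n), (k.factorial : F)⁻¹ • (ad F L x ^ k) y :=
        (Finset.eventually_constant_sum (term_eq_zero pow_finrank) (le_max_left _ _)).symm
    _ = ∑ k ∈ Finset.range n, (k.factorial : F)⁻¹ • (ad F L x ^ k) y :=
        Finset.eventually_constant_sum (term_eq_zero hn) (le_max_right _ _)

omit [FiniteDimensional F L] in
theorem semiconjBy_expAd {δ : End F L} {x y : L}
    (hδ : SemiconjBy δ (ad F L x : End F L) (ad F L y)) :
    SemiconjBy δ (expAd F x) (expAd F y) := by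
  rw [SemiconjBy, expAd, expAd, Finset.mul_sum, Finset.sum_mul]
  refine Finset.sum_congr rfl fun k _ ↦ ?_
  rw [mul_smul_comm, smul_mul_assoc, (hδ.pow_right k).eq]

variable [CharZero F]

theorem expAd_eq_exp [Module ℚ L] {x : L} (hx : IsNilpotent (ad F L x)) :
    expAd F x = IsNilpotent.exp (ad F L x : End F L) := by
  rw [IsNilpotent.exp_eq_sum (pow_finrank_eq_zero_of_isNilpotent hx), expAd]
  refine Finset.sum_congr rfl fun k _ ↦ LinearMap.ext fun y ↦ ?_
  rw [LinearMap.smul_apply, LinearMap.smul_apply, ← Rat.cast_smul_eq_qsmul F, Rat.cast_inv,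
    Rat.cast_natCast]

theorem expAd_mul_expAd_neg {x : L} (hx : IsNilpotent (ad F L x)) :
    expAd F x * expAd F (-x) = 1 := by
  let : Module ℚ L := Module.compHom L (algebraMap ℚ F)
  rw [expAd_eq_exp hx, expAd_eq_exp (by rw [map_neg]; exact hx.neg), map_neg,
    hx.exp_mul_exp_neg_self]

theorem expAd_lie {x : L} (hx : IsNilpotent (ad F L x)) (y z : L) :
    expAd F x ⁅y, z⁆ = ⁅expAd F x y, expAd F x z⁆ := by
  let : Module ℚ L := Module.compHom L (algebraMap ℚ F)
  let : LieAlgebra ℚ L := { lie_smul := fun q y z ↦ lie_smul (algebraMap ℚ F q) y z }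
  have ad_eq : (LieDerivation.ad F L x).toLinearMap = ad F L x := by ext; simp
  have map_lie :=
    (LieDerivation.exp (LieDerivation.ad F L x) (by rwa [ad_eq])).toLieHom.map_lie y z
  simp only [LieEquiv.coe_toLieHom, LieDerivation.exp_map_apply, ad_eq] at map_lie
  rw [expAd_eq_exp hx, map_lie]

end ExpAd

section GradedPiece

open Module LieAlgebra

variable {F L : Type*} [Field F] [LieRing L] [LieAlgebra F L] {h e f : L}

/-- The eigenspace of `ad h` for the eigenvalue `2 * j`, that is, the piece of degree `j` of the
grading of `L` defined by an even `sl₂`-triple `(h, e, f)`. -/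
def gradedPiece (F : Type*) {L : Type*} [Field F] [LieRing L] [LieAlgebra F L]
    (h : L) (j : ℤ) : Submodule F L :=
  (ad F L h : End F L).eigenspace (2 * j : F)

theorem mem_gradedPiece {j : ℤ} {v : L} : v ∈ gradedPiece F h j ↔ ⁅h, v⁆ = (2 * j : F) • v := by
  rw [gradedPiece, End.mem_eigenspace_iff, ad_apply]

theorem lie_mem_gradedPiece {i j : ℤ} {x y : L} (hx : x ∈ gradedPiece F h i)
    (hy : y ∈ gradedPiece F h j) : ⁅x, y⁆ ∈ gradedPiece F h (i + j) := by
  rw [mem_gradedPiece] at hx hy ⊢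
  rw [leibniz_lie, hx, hy, smul_lie, lie_smul, ← add_smul, Int.cast_add, mul_add]

theorem e_mem_gradedPiece_one (t : IsSl2Triple h e f) : e ∈ gradedPiece F h 1 := by
  rw [mem_gradedPiece, t.lie_h_e_smul F, Int.cast_one, mul_one]

theorem f_mem_gradedPiece_neg_one (t : IsSl2Triple h e f) : f ∈ gradedPiece F h (-1) := by
  rw [mem_gradedPiece, t.lie_lie_smul_f F, Int.cast_neg, Int.cast_one, mul_neg_one, neg_smul]

theorem semiconjBy_ad_smul (iSup_eq_top : ⨆ j, gradedPiece F h j = ⊤)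
    {δ : End F L} {u : F} (hu : u ≠ 0)
    (hδ : ∀ j, ∀ v ∈ gradedPiece F h j, δ v = u ^ j • v) {k : ℤ} {x : L}
    (hx : x ∈ gradedPiece F h k) :
    SemiconjBy δ (ad F L x : End F L) (ad F L (u ^ k • x)) := by
  suffices ⊤ ≤ LinearMap.eqLocus (δ * ad F L x) (ad F L (u ^ k • x) * δ) from
    LinearMap.ext fun _ ↦ this Submodule.mem_top
  refine iSup_eq_top.ge.trans (iSup_le fun j v hv ↦ ?_)
  rw [LinearMap.mem_eqLocus, End.mul_apply, End.mul_apply, ad_apply, ad_apply,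
    hδ _ _ (lie_mem_gradedPiece hx hv), hδ j v hv, smul_lie, lie_smul, smul_smul, zpow_add₀ hu]

theorem semiconjBy_weylAd (t : IsSl2Triple h e f)
    (iSup_eq_top : ⨆ j, gradedPiece F h j = ⊤) {δ : End F L} {u : F} (hu : u ≠ 0)
    (hδ : ∀ j, ∀ v ∈ gradedPiece F h j, δ v = u ^ j • v) :
    SemiconjBy δ (weylAd e f 1) (weylAd e f u) := by
  have exp_e : SemiconjBy δ (expAd F e) (expAd F (u • e)) := by
    simpa using semiconjBy_expAd (semiconjBy_ad_smul iSup_eq_top hu hδ (e_mem_gradedPiece_one t))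
  have exp_f : SemiconjBy δ (expAd F (-f)) (expAd F (-u⁻¹ • f)) := by
    simpa using semiconjBy_expAd (semiconjBy_ad_smul iSup_eq_top hu hδ
      (neg_mem (f_mem_gradedPiece_neg_one t)))
  simpa [weylAd] using (exp_e.mul_right exp_f).mul_right exp_e

variable [CharZero F]

theorem injective_two_mul_intCast : Function.Injective fun j : ℤ ↦ (2 * j : F) := fun i j hij ↦ by
  simpa using hij

theorem iSupIndep_gradedPiece : iSupIndep (gradedPiece F h) :=
  (ad F L h : End F L).eigenspaces_iSupIndep.comp injective_two_mul_intCast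

variable [FiniteDimensional F L]

/- For `u = s²` this is the action of `diag(s, s⁻¹)`; conjugation by it carries `weylAd e f 1` to
`weylAd e f u`, which determines `torusAd e f u`. -/
theorem exists_forall_gradedPiece_apply_eq_smul (h : L) (u : F) :
    ∃ δ : End F L, ∀ j, ∀ v ∈ gradedPiece F h j, δ v = u ^ j • v := by
  obtain ⟨δ, hδ⟩ := exists_forall_apply_eq_smul_of_mem_eigenspace (ad F L h : End F L)
    fun μ ↦ u ^ Function.invFun (fun j : ℤ ↦ (2 * j : F)) μ
  refine ⟨δ, fun j v hv ↦ ?_⟩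
  rw [hδ _ v hv]
  exact congr_arg (u ^ · • v) (Function.leftInverse_invFun injective_two_mul_intCast j)

variable (iSup_eq_top : ⨆ j, gradedPiece F h j = ⊤)

include iSup_eq_top

theorem isNilpotent_ad_of_mem_gradedPiece {k : ℤ} (hk : k ≠ 0) {x : L}
    (hx : x ∈ gradedPiece F h k) : IsNilpotent (ad F L x) :=
  isNilpotent_of_forall_apply_mem_add iSupIndep_gradedPiece iSup_eq_top hk fun j v hv ↦ by
    rw [add_comm]
    exact lie_mem_gradedPiece hx hv

theorem isNilpotent_ad_smul_e (t : IsSl2Triple h e f) (a : F) : IsNilpotent (ad F L (a • e)) :=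
  isNilpotent_ad_of_mem_gradedPiece iSup_eq_top one_ne_zero
    (Submodule.smul_mem _ a (e_mem_gradedPiece_one t))

theorem isNilpotent_ad_smul_f (t : IsSl2Triple h e f) (a : F) : IsNilpotent (ad F L (a • f)) :=
  isNilpotent_ad_of_mem_gradedPiece iSup_eq_top (neg_ne_zero.mpr one_ne_zero)
    (Submodule.smul_mem _ a (f_mem_gradedPiece_neg_one t))

end GradedPiece

section Torus

open Module LieAlgebra

variable {F L : Type*} [Field F] [CharZero F] [LieRing L] [LieAlgebra F L] [FiniteDimensional F L]
  {h e f : L}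

theorem weylAd_neg_one_apply_h (t : IsSl2Triple h e f) : weylAd e f (-1 : F) h = -h := by
  have lie_e_h : ⁅e, h⁆ = -((2 : F) • e) := by rw [← lie_skew, t.lie_h_e_smul F]
  have lie_f_h : ⁅f, h⁆ = (2 : F) • f := by rw [← lie_skew, t.lie_lie_smul_f F, neg_neg]
  have lie_f_e : ⁅f, e⁆ = -h := by rw [← lie_skew, t.lie_e_f]
  have exp_e_h : expAd F ((-1 : F) • e) h = h + (2 : F) • e := by
    rw [expAd_apply_eq_sum (n := 2) (by simp [pow_succ, lie_e_h])]
    simp [Finset.sum_range_succ, lie_e_h]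
  have exp_f : expAd F ((1 : F) • f) (h + (2 : F) • e) = -h + (2 : F) • e := by
    rw [expAd_apply_eq_sum (n := 3) (by simp [pow_succ, lie_f_h, lie_f_e])]
    simp only [Finset.sum_range_succ, Finset.sum_range_zero, pow_succ, pow_zero, one_mul,
      End.mul_apply, End.one_apply, ad_apply, one_smul, lie_add, lie_smul, lie_f_h, lie_f_e,
      lie_neg, lie_self, smul_zero, Nat.factorial, Nat.cast_one, inv_one]
    module
  have exp_e_neg_h : expAd F ((-1 : F) • e) (-h + (2 : F) • e) = -h := by
    rw [expAd_apply_eq_sum (n := 2) (by simp [pow_succ, lie_e_h])]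
    simp [Finset.sum_range_succ, lie_e_h]
  rw [weylAd, inv_neg, inv_one, neg_neg, End.mul_apply, End.mul_apply, exp_e_h, exp_f, exp_e_neg_h]

variable (iSup_eq_top : ⨆ j, gradedPiece F h j = ⊤)

include iSup_eq_top

theorem weylAd_one_mul_weylAd_neg_one (t : IsSl2Triple h e f) :
    weylAd e f (1 : F) * weylAd e f (-1 : F) = 1 := by
  have exp_e := expAd_mul_expAd_neg (isNilpotent_ad_smul_e iSup_eq_top t (1 : F))
  have exp_f := expAd_mul_expAd_neg (isNilpotent_ad_smul_f iSup_eq_top t (-1 : F))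
  rw [← neg_smul] at exp_e exp_f
  rw [neg_neg] at exp_f
  simp only [weylAd, inv_neg, inv_one, neg_neg]
  calc _ = expAd F ((1 : F) • e) * (expAd F ((-1 : F) • f) *
        (expAd F ((1 : F) • e) * expAd F ((-1 : F) • e)) * expAd F ((1 : F) • f)) *
        expAd F ((-1 : F) • e) := by noncomm_ring
    _ = 1 := by rw [exp_e, mul_one, exp_f, mul_one, exp_e]

theorem weylAd_lie (t : IsSl2Triple h e f) (u : F) (y z : L) :
    weylAd e f u ⁅y, z⁆ = ⁅weylAd e f u y, weylAd e f u z⁆ := by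
  simp only [weylAd, End.mul_apply, expAd_lie (isNilpotent_ad_smul_e iSup_eq_top t _),
    expAd_lie (isNilpotent_ad_smul_f iSup_eq_top t _)]

theorem weylAd_neg_one_mem_gradedPiece (t : IsSl2Triple h e f) {j : ℤ} {v : L}
    (hv : v ∈ gradedPiece F h j) : weylAd e f (-1 : F) v ∈ gradedPiece F h (-j) := by
  rw [mem_gradedPiece] at hv ⊢
  have := weylAd_lie iSup_eq_top t (-1) h v
  rw [hv, weylAd_neg_one_apply_h t, map_smul, neg_lie, eq_comm, neg_eq_iff_eq_neg] at this
  rw [this, Int.cast_neg, mul_neg, neg_smul]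

theorem gradedPiece_neg_eq_bot (t : IsSl2Triple h e f) {j : ℤ} (hj : gradedPiece F h j = ⊥) :
    gradedPiece F h (-j) = ⊥ := by
  refine (Submodule.eq_bot_iff _).mpr fun v hv ↦ ?_
  have apply_eq_zero : weylAd e f (-1 : F) v = 0 := by
    simpa [hj] using weylAd_neg_one_mem_gradedPiece iSup_eq_top t hv
  rw [← End.one_apply (R := F) v, ← weylAd_one_mul_weylAd_neg_one iSup_eq_top t, End.mul_apply,
    apply_eq_zero, map_zero]

theorem torusAd_apply_of_mem_gradedPiece (t : IsSl2Triple h e f) {u : F} (hu : u ≠ 0) {j : ℤ}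
    {v : L} (hv : v ∈ gradedPiece F h j) : torusAd e f u v = u ^ (2 * j) • v := by
  obtain ⟨δ, hδ⟩ := exists_forall_gradedPiece_apply_eq_smul h u
  set w := weylAd e f (-1 : F) v
  have weylAd_w : weylAd e f (1 : F) w = v := by
    rw [← End.mul_apply, weylAd_one_mul_weylAd_neg_one iSup_eq_top t, End.one_apply]
  have w_eq : w = u ^ j • δ w := by
    rw [hδ _ w (weylAd_neg_one_mem_gradedPiece iSup_eq_top t hv), smul_smul, ← zpow_add₀ hu,
      add_neg_cancel, zpow_zero, one_smul]
  calc torusAd e f u v = weylAd e f u w := rfl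
    _ = u ^ j • weylAd e f u (δ w) := by rw [← map_smul, ← w_eq]
    _ = u ^ j • δ (weylAd e f (1 : F) w) := by
      rw [← End.mul_apply, ← (semiconjBy_weylAd t iSup_eq_top hu hδ).eq, End.mul_apply]
    _ = u ^ (2 * j) • v := by rw [weylAd_w, hδ j v hv, smul_smul, ← zpow_add₀ hu, two_mul]

end Torus

section RegularElements

open Module LieAlgebra

theorem isCartanSubalgebra_engel_of_isRegular {K L : Type*} [Field K] [Infinite K] [LieRing L]
    [LieAlgebra K L] [FiniteDimensional K L] {x : L} (hx : IsRegular K x) :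
    (LieSubalgebra.engel K x).IsCartanSubalgebra := by
  refine ⟨LieSubalgebra.isNilpotent_of_forall_le_engel _ fun y hy ↦ ?_,
    LieSubalgebra.normalizer_engel _ _⟩
  let E : {LieSubalgebra.engel K z | z ∈ LieSubalgebra.engel K x} :=
    ⟨LieSubalgebra.engel K x, x, LieSubalgebra.self_mem_engel _ _, rfl⟩
  suffices IsMin E from
    engel_isBot_of_isMin (Cardinal.natCast_le_aleph0.trans (Cardinal.aleph0_le_mk K)) _ E le_rfl
      this ⟨LieSubalgebra.engel K y, y, hy, rfl⟩
  rintro ⟨_, z, -, rfl⟩ (hzx : LieSubalgebra.engel K z ≤ LieSubalgebra.engel K x)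
  have finrank_le : finrank K (LieSubalgebra.engel K x) ≤ finrank K (LieSubalgebra.engel K z) := by
    rw [(isRegular_iff_finrank_engel_eq_rank K x).mp hx]
    exact rank_le_finrank_engel K z
  exact (LieSubalgebra.toSubmodule_injective
    (Submodule.eq_of_le_of_finrank_le hzx finrank_le)).ge

end RegularElements

section PrincipalTriples

open Module LieModule LieAlgebra

namespace IsPrincipalSl2Triple

variable {F L : Type*} [Field F] [CharZero F] [LieRing L] [LieAlgebra F L] [FiniteDimensional F L]
  {h e f : L} (hp : IsPrincipalSl2Triple F h e f)

include hp

theorem weightMultiplicity_zero_add_one_le_rank :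
    weightMultiplicity L h (0 : F) + weightMultiplicity L h (1 : F) ≤ LieAlgebra.rank F L :=
  (weightMultiplicity_zero_add_one_le_finrank_ker L hp.isSl2Triple).trans_eq
    hp.finrank_centralizer

theorem isRegular : IsRegular F h :=
  (isRegular_iff_finrank_engel_eq_rank F h).mpr <| le_antisymm
    ((Nat.le_add_right _ _).trans hp.weightMultiplicity_zero_add_one_le_rank)
    (rank_le_finrank_engel F h)

theorem weightMultiplicity_one : weightMultiplicity L h (1 : F) = 0 := by
  have rank_le : LieAlgebra.rank F L ≤ weightMultiplicity L h (0 : F) := rank_le_finrank_engel F h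
  have := hp.weightMultiplicity_zero_add_one_le_rank
  omega

theorem exists_two_mul_of_weightMultiplicity_ne_zero {μ : F} (hμ : weightMultiplicity L h μ ≠ 0) :
    ∃ j : ℤ, μ = 2 * j :=
  PrincipalAutomorphism.exists_two_mul_of_weightMultiplicity_ne_zero L hp.isSl2Triple
    hp.weightMultiplicity_one hμ

variable [IsKilling F L] [IsAlgClosed F]

theorem isSemisimple_ad : (ad F L h).IsSemisimple :=
  have := isCartanSubalgebra_engel_of_isRegular hp.isRegular
  IsKilling.isSemisimple_ad_of_mem_isCartanSubalgebra (LieSubalgebra.self_mem_engel F h)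

theorem maxGenEigenspace_eq_gradedPiece (j : ℤ) :
    (toEnd F L L h).maxGenEigenspace (2 * j : F) = gradedPiece F h j :=
  hp.isSemisimple_ad.isFinitelySemisimple.maxGenEigenspace_eq_eigenspace _

theorem iSup_gradedPiece_eq_top : ⨆ j, gradedPiece F h j = ⊤ := by
  rw [eq_top_iff, ← (toEnd F L L h).iSup_maxGenEigenspace_eq_top]
  refine iSup_le fun μ ↦ ?_
  by_cases hμ : weightMultiplicity L h μ = 0
  · exact (weightMultiplicity_eq_zero.mp hμ).trans_le bot_le
  · obtain ⟨j, rfl⟩ := hp.exists_two_mul_of_weightMultiplicity_ne_zero hμ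
    exact (hp.maxGenEigenspace_eq_gradedPiece j).trans_le (le_iSup (gradedPiece F h) j)

theorem finrank_gradedPiece_le {i j : ℤ} (hij : (0 ≤ i ∧ i ≤ j) ∨ (j ≤ i ∧ i ≤ 0)) :
    finrank F (gradedPiece F h j) ≤ finrank F (gradedPiece F h i) := by
  rw [← hp.maxGenEigenspace_eq_gradedPiece, ← hp.maxGenEigenspace_eq_gradedPiece]
  exact weightMultiplicity_two_mul_le L hp.isSl2Triple hij

theorem gradedPiece_eq_bot_of_le {n : ℕ} (hbot : gradedPiece F h n = ⊥) {j : ℤ} (hj : n ≤ |j|) :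
    gradedPiece F h j = ⊥ := by
  have eq_bot {i : ℤ} (hi : n ≤ i) : gradedPiece F h i = ⊥ := by
    have := hp.finrank_gradedPiece_le (Or.inl ⟨Int.natCast_nonneg n, hi⟩)
    rwa [hbot, finrank_bot, Nat.le_zero, Submodule.finrank_eq_zero] at this
  rcases le_abs.mp hj with hj | hj
  · exact eq_bot hj
  · rw [← neg_neg j]
    exact gradedPiece_neg_eq_bot hp.iSup_gradedPiece_eq_top hp.isSl2Triple (eq_bot hj)

theorem eqLocus_torusAd_eq_iSup {m : ℕ} (hm : 0 < m) {ζ : F} (hζ : IsPrimitiveRoot ζ (2 * m)) :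
    LinearMap.eqLocus (torusAd e f ζ) (1 : End F L) =
      ⨆ j ∈ {j : ℤ | (m : ℤ) ∣ j}, gradedPiece F h j := by
  have zpow_eq_one_iff (j : ℤ) : ζ ^ (2 * j) = 1 ↔ (m : ℤ) ∣ j := by
    rw [hζ.zpow_eq_one_iff_dvd, Nat.cast_mul]
    exact mul_dvd_mul_iff_left two_ne_zero
  rw [eqLocus_one_eq_iSup (torusAd e f ζ) hp.iSup_gradedPiece_eq_top fun j v hv ↦
    torusAd_apply_of_mem_gradedPiece hp.iSup_gradedPiece_eq_top hp.isSl2Triple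
      (hζ.ne_zero (by omega)) hv]
  simp only [iSup_subtype, zpow_eq_one_iff, Set.mem_ofPred_eq]

theorem fixedDim_eq_finrank_iSup {m : ℕ} (hm : 0 < m) {ζ : F} (hζ : IsPrimitiveRoot ζ (2 * m)) :
    fixedDim e f ζ = finrank F ↥(⨆ i : ℤ, gradedPiece F h (m * i)) := by
  have range_eq : Set.range (fun i : ℤ ↦ (m * i : ℤ)) = {j : ℤ | (m : ℤ) ∣ j} :=
    Set.ext fun _ ↦ exists_congr fun _ ↦ eq_comm
  rw [fixedDim, hp.eqLocus_torusAd_eq_iSup hm hζ, ← range_eq, iSup_range]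

theorem fixedDim_le {m m' : ℕ} (hm : 0 < m) (hm' : 0 < m') {ζ ζ' : F}
    (hζ : IsPrimitiveRoot ζ (2 * m)) (hζ' : IsPrimitiveRoot ζ' (2 * m')) (hlt : m' < m) :
    fixedDim e f ζ ≤ fixedDim e f ζ' := by
  rw [hp.fixedDim_eq_finrank_iSup hm hζ, hp.fixedDim_eq_finrank_iSup hm' hζ']
  have indep : iSupIndep fun i : ℤ ↦ gradedPiece F h (m' * i) :=
    iSupIndep_gradedPiece.comp (mul_right_injective₀ (Nat.cast_ne_zero.mpr hm'.ne'))
  refine finrank_iSup_le_finrank_iSup indep fun i ↦ hp.finrank_gradedPiece_le ?_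
  have m'_nonneg : (0 : ℤ) ≤ m' := Int.natCast_nonneg m'
  have m'_le : (m' : ℤ) ≤ m := Int.ofNat_le.mpr hlt.le
  rcases le_total 0 i with hi | hi
  · exact Or.inl ⟨mul_nonneg m'_nonneg hi, mul_le_mul_of_nonneg_right m'_le hi⟩
  · exact Or.inr ⟨mul_le_mul_of_nonpos_right m'_le hi, mul_nonpos_of_nonneg_of_nonpos m'_nonneg hi⟩

theorem fixedDim_lt {m m' : ℕ} (hm : 0 < m) (hm' : 0 < m') {ζ ζ' : F}
    (hζ : IsPrimitiveRoot ζ (2 * m)) (hζ' : IsPrimitiveRoot ζ' (2 * m')) (hdvd : m' ∣ m)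
    (hne : m' ≠ m) (hbot : gradedPiece F h m' ≠ ⊥) : fixedDim e f ζ < fixedDim e f ζ' := by
  rw [fixedDim, fixedDim, hp.eqLocus_torusAd_eq_iSup hm hζ, hp.eqLocus_torusAd_eq_iSup hm' hζ']
  have not_dvd : (m' : ℤ) ∉ {j : ℤ | (m : ℤ) ∣ j} := fun hmem ↦
    hne (Nat.dvd_antisymm hdvd (Int.natCast_dvd_natCast.mp hmem))
  have disjoint := (iSupIndep_gradedPiece (F := F) (h := h)).disjoint_biSup not_dvd
  have le : gradedPiece F h m' ≤ ⨆ j ∈ {j : ℤ | (m' : ℤ) ∣ j}, gradedPiece F h j :=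
    le_biSup (gradedPiece F h) (dvd_refl (m' : ℤ))
  refine Submodule.finrank_lt_finrank_of_lt (lt_of_le_of_ne (biSup_mono fun j hj ↦ ?_) fun heq ↦ ?_)
  · exact (Int.natCast_dvd_natCast.mpr hdvd).trans hj
  · exact hbot (disjoint.eq_bot_of_le (le.trans_eq heq.symm))

end IsPrincipalSl2Triple

end PrincipalTriples

section Ideals

open Module LieModule LieAlgebra

variable {F L : Type*} [Field F] [LieRing L] [LieAlgebra F L] (I : LieIdeal F L)

theorem coe_toEnd_sub_smul_pow_apply (x : L) (μ : F) (k : ℕ) (v : I) :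
    (((toEnd F L I x - μ • 1) ^ k) v : L) = ((toEnd F L L x - μ • 1) ^ k) (v : L) := by
  induction k with
  | zero => rfl
  | succ k ih =>
    rw [pow_succ', pow_succ', End.mul_apply, End.mul_apply, ← ih]
    rfl

variable {I} in
theorem mem_maxGenEigenspace_toEnd_iff_coe_mem {x : L} {μ : F} {v : I} :
    v ∈ (toEnd F L I x).maxGenEigenspace μ ↔ (v : L) ∈ (toEnd F L L x).maxGenEigenspace μ := by
  simp only [End.mem_maxGenEigenspace, ← coe_toEnd_sub_smul_pow_apply, ZeroMemClass.coe_eq_zero]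

variable [FiniteDimensional F L]

theorem weightMultiplicity_ideal_le (x : L) (μ : F) :
    weightMultiplicity I x μ ≤ weightMultiplicity L x μ := by
  refine (LinearEquiv.finrank_eq (Submodule.equivMapOfInjective I.toSubmodule.subtype
    I.toSubmodule.subtype_injective _)).trans_le (Submodule.finrank_mono ?_)
  rintro _ ⟨v, hv, rfl⟩
  exact mem_maxGenEigenspace_toEnd_iff_coe_mem.mp hv

variable [IsKilling F L]

theorem exists_ad_eq_toEnd (x : L) : ∃ y : I, ad F I y = toEnd F L I x := by
  obtain ⟨y, hy, z, hz, rfl⟩ := (LieSubmodule.mem_sup _ _ x).mp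
    (I.isCompl_killingCompl.sup_eq_top ▸ LieSubmodule.mem_top x)
  refine ⟨⟨y, hy⟩, LinearMap.ext fun v ↦ Subtype.ext ?_⟩
  have lie_z : ⁅z, (v : L)⁆ = 0 :=
    Submodule.disjoint_def.mp
      (LieSubmodule.disjoint_toSubmodule.mpr I.isCompl_killingCompl.disjoint) _
      (lie_mem_right F L I z v v.2) (lie_mem_left F L _ z v hz)
  change ⁅y, (v : L)⁆ = ⁅y + z, (v : L)⁆
  rw [add_lie, lie_z, add_zero]

/- Modulo the centralizer of `I`, the element `x` is an element `y` of `I`, and the Engel subalgebra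
of `y` in `I` embeds into that of `x`. -/
theorem exists_isCartanSubalgebra_finrank_eq {x : L}
    (hx : (LieSubalgebra.engel F x).IsCartanSubalgebra) :
    ∃ H : LieSubalgebra F I,
      H.IsCartanSubalgebra ∧ finrank F H = weightMultiplicity I x (0 : F) := by
  obtain ⟨y, hy⟩ := exists_ad_eq_toEnd I x
  have mem_engel {v : I} (hv : v ∈ LieSubalgebra.engel F y) :
      (v : L) ∈ LieSubalgebra.engel F x := by
    change v ∈ (ad F I y).maxGenEigenspace 0 at hv
    rw [hy] at hv
    exact mem_maxGenEigenspace_toEnd_iff_coe_mem.mp hv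
  have isLieAbelian : IsLieAbelian (LieSubalgebra.engel F y) := ⟨fun a b ↦ by
    have lie_eq_zero := congrArg Subtype.val (trivial_lie_zero (LieSubalgebra.engel F x)
      (LieSubalgebra.engel F x) ⟨a, mem_engel a.2⟩ ⟨b, mem_engel b.2⟩)
    exact Subtype.ext (Subtype.ext lie_eq_zero)⟩
  refine ⟨LieSubalgebra.engel F y, ⟨inferInstance, LieSubalgebra.normalizer_engel F y⟩, ?_⟩
  rw [weightMultiplicity, ← hy]
  rfl

end Ideals

section CoxeterNumber

open Module LieModule LieAlgebra

variable {F L : Type*} [Field F] [IsAlgClosed F] [CharZero F] [LieRing L] [LieAlgebra F L]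
  [FiniteDimensional F L]

theorem finrank_add_card_root_le [IsKilling F L] (H : LieSubalgebra F L) [H.IsCartanSubalgebra] :
    finrank F H + Nat.card H.root ≤ finrank F L := by
  let χ : Option H.root → H → F := fun o ↦ o.elim 0 fun α ↦ α.1
  have root_ne_zero (α : H.root) : (α.1 : H → F) ≠ 0 := (Finset.mem_filter.mp α.2).2
  have injective : χ.Injective := by
    rintro (_ | α) (_ | β) hαβ
    · rfl
    · exact (root_ne_zero β hαβ.symm).elim
    · exact (root_ne_zero α hαβ).elim
    · exact congrArg some (Subtype.ext (DFunLike.coe_injective hαβ))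
  have indep := (LieSubmodule.iSupIndep_toSubmodule.mpr
    (iSupIndep_genWeightSpace F H L)).comp injective
  have sum_le := sum_finrank_le_of_iSupIndep indep Finset.univ (U := ⊤) fun _ _ ↦ le_top
  rw [Fintype.sum_option, finrank_top] at sum_le
  refine le_trans (le_of_eq ?_) sum_le
  congr 1
  · exact congrArg (fun W : LieSubmodule F H L ↦ finrank F W) (rootSpace_zero_eq F L H).symm
  · rw [Nat.card_eq_fintype_card, Fintype.card_eq_sum_ones]
    exact Finset.sum_congr rfl fun α _ ↦
      (IsKilling.finrank_rootSpace_eq_one α.1 (root_ne_zero α)).symm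

theorem finrank_mul_simpleCoxeterNumber_add_one_le [IsSimple F L] (H : LieSubalgebra F L)
    [H.IsCartanSubalgebra] (finrank_pos : 0 < finrank F H) :
    finrank F H * (simpleCoxeterNumber F L + 1) ≤ finrank F L := by
  let P := IsKilling.rootSystem H
  obtain ⟨b⟩ := RootPairing.nonempty_base P
  have card_support : b.support.card = finrank F H := by
    rw [← Subspace.dual_finrank_eq, finrank_eq_card_basis b.toWeightBasis, Fintype.card_coe]
  have : Nonempty H.root :=
    (Finset.card_pos.mp (card_support ▸ finrank_pos)).to_subtype.map Subtype.val
  obtain ⟨l, nodup, mem_iff, card_mul_orderOf_le⟩ := exists_card_support_mul_orderOf_le b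
  rw [card_support] at card_mul_orderOf_le
  have le_orderOf : simpleCoxeterNumber F L ≤ orderOf (l.map P.reflection).prod :=
    Nat.sInf_le ⟨H, inferInstance, _, ⟨b, l, nodup, mem_iff, rfl⟩, rfl⟩
  calc finrank F H * (simpleCoxeterNumber F L + 1)
      ≤ finrank F H * orderOf (l.map P.reflection).prod + finrank F H := by
        rw [mul_add_one]
        gcongr
    _ ≤ finrank F H + Nat.card H.root := by rw [add_comm]; gcongr
    _ ≤ finrank F L := finrank_add_card_root_le H

namespace IsPrincipalSl2Triple

variable [IsKilling F L] {h e f : L} (hp : IsPrincipalSl2Triple F h e f)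

include hp

theorem finrank_ideal_le {n : ℕ} (hbot : gradedPiece F h (n + 1 : ℕ) = ⊥) (I : LieIdeal F L) :
    finrank F I ≤ (2 * n + 1) * weightMultiplicity I h (0 : F) := by
  refine finrank_le_mul_weightMultiplicity_zero I hp.isSl2Triple fun μ hμ ↦ ?_
  have ne_zero : weightMultiplicity L h μ ≠ 0 := fun h0 ↦
    hμ (Nat.le_zero.mp ((weightMultiplicity_ideal_le I h μ).trans_eq h0))
  obtain ⟨j, rfl⟩ := hp.exists_two_mul_of_weightMultiplicity_ne_zero ne_zero
  refine ⟨j, ?_, rfl⟩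
  by_contra! hj
  refine ne_zero (weightMultiplicity_eq_zero.mpr ?_)
  rw [hp.maxGenEigenspace_eq_gradedPiece]
  exact hp.gradedPiece_eq_bot_of_le hbot (by push_cast; omega)

theorem simpleCoxeterNumber_le {n : ℕ} (hbot : gradedPiece F h (n + 1 : ℕ) = ⊥) (I : LieIdeal F L)
    [IsSimple F I] : simpleCoxeterNumber F I ≤ 2 * n := by
  obtain ⟨H, _, finrank_H⟩ := exists_isCartanSubalgebra_finrank_eq I
    (isCartanSubalgebra_engel_of_isRegular hp.isRegular)
  have finrank_I_le := hp.finrank_ideal_le hbot I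
  rw [← finrank_H, mul_comm] at finrank_I_le
  have finrank_I_pos : 0 < finrank F I :=
    have : Nontrivial I := not_subsingleton_iff_nontrivial.mp fun _ ↦
      IsSimple.non_abelian F (L := I) ⟨fun _ _ ↦ Subsingleton.elim _ _⟩
    finrank_pos
  have finrank_H_pos : 0 < finrank F H :=
    Nat.pos_of_mul_pos_right (finrank_I_pos.trans_le finrank_I_le)
  have := (finrank_mul_simpleCoxeterNumber_add_one_le H finrank_H_pos).trans finrank_I_le
  exact Nat.succ_le_succ_iff.mp (Nat.le_of_mul_le_mul_left this finrank_H_pos)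

theorem coxeterNumber_le {m n : ℕ} (hbot : gradedPiece F h (n + 1 : ℕ) = ⊥) (hm : 0 < m)
    (hnm : 2 * n ≤ m) : coxeterNumber F L ≤ m := by
  refine csSup_le ⟨1, Or.inl rfl⟩ ?_
  rintro _ (rfl | ⟨I, _, rfl⟩)
  · exact hm
  · exact (hp.simpleCoxeterNumber_le hbot I).trans hnm

end IsPrincipalSl2Triple

end CoxeterNumber

end PrincipalAutomorphism

theorem proposition2p2 {F : Type*} [Field F] [IsAlgClosed F] [CharZero F]
    {L : Type*} [LieRing L] [LieAlgebra F L] [FiniteDimensional F L]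
    [LieAlgebra.IsSemisimple F L]
    {h e f : L} (hprin : PrincipalAutomorphism.IsPrincipalSl2Triple F h e f)
    {m m' : ℕ} (hm : 0 < m) (hm' : 0 < m')
    {ζ ζ' : F} (hζ : IsPrimitiveRoot ζ (2 * m)) (hζ' : IsPrimitiveRoot ζ' (2 * m')) :
    (m' < m → PrincipalAutomorphism.fixedDim e f ζ' ≥ PrincipalAutomorphism.fixedDim e f ζ) ∧
    (m' ∣ m → m' ≠ m → m < PrincipalAutomorphism.coxeterNumber F L →
      PrincipalAutomorphism.fixedDim e f ζ' > PrincipalAutomorphism.fixedDim e f ζ) := by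
  refine ⟨hprin.fixedDim_le hm hm' hζ hζ', fun hdvd hne hlt ↦ ?_⟩
  have two_mul_le : 2 * m' ≤ m := by
    obtain ⟨k, rfl⟩ := hdvd
    rw [mul_comm]
    exact Nat.mul_le_mul_left m' ((Nat.two_le_iff k).mpr
      ⟨by rintro rfl; simp at hm, by rintro rfl; simp at hne⟩)
  refine hprin.fixedDim_lt hm hm' hζ hζ' hdvd hne fun hbot ↦ hlt.not_ge ?_
  obtain ⟨n, rfl⟩ := Nat.exists_eq_add_one_of_ne_zero hm'.ne'
  exact hprin.coxeterNumber_le hbot hm (by omega)
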